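/- Let $f(x,y)=\left(y,\ \tfrac{x}{2}-y^3+\tfrac{3}{4}y\right)$, considered as a map of $\mathbb{C}^2$ to itself and, by restriction, of $\mathbb{R}^2\subset\mathbb{C}^2$ to itself; $f^n$ denotes its $n$-th iterate. It has the attracting fixed points $p_+=(\tfrac12,\tfrac12)$ and $p_-=(-\tfrac12,-\tfrac12)$, a saddle fixed point at the origin $0$, and a saddle cycle of period two $\{p,p'\}$ with $p=(-\tfrac{\sqrt5}{2},\tfrac{\sqrt5}{2})$ and $p'=(\tfrac{\sqrt5}{2},-\tfrac{\sqrt5}{2})$. Let $$\Omega_\pm=\{z\in\mathbb{C}^2:\ f^n(z)\to p_\pm \text{ as } n\to\infty\}\cap\mathbb{R}^2$$ be the real basins of $p_\pm$, and let $$W^s(0)=\{q\in\mathbb{R}^2:\ f^n(q)\to 0\},\qquad W^s(p,p')=\{q\in\mathbb{R}^2:\ d(f^n(q),\{p,p'\})\to 0\}$$ be the real stable sets of the two saddles, where $d$ is the Euclidean distance. Let $K^+\subset\mathbb{C}^2$ be the set of points whose forward orbit $\{f^n(z):n\ge 0\}$ is bounded, let $J^+=\partial K^+$ be its boundary in $\mathbb{C}^2$,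 and let $J^+_{\mathbb{R}}=J^+\cap\mathbb{R}^2$. Then, with the boundaries of $\Omega_\pm$ taken in $\mathbb{R}^2$, $$\partial\Omega_+=\partial\Omega_-=W^s(0)\cup W^s(p,p')=J^+_{\mathbb{R}}.$$ -/

import Mathlib

open Filter Topology

namespace BieberbachMap

/-- Bieberbach's cubic Hénon map `f(x, y) = (y, x/2 - y³ + 3y/4)` over a field `𝕜`
(used for `𝕜 = ℂ` and `𝕜 = ℝ`). -/
def f (𝕜 : Type*) [Field 𝕜] (q : 𝕜 × 𝕜) : 𝕜 × 𝕜 :=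
  (q.2, q.1 / 2 - q.2 ^ 3 + 3 / 4 * q.2)

/-- The inclusion of `ℝ²` in `ℂ²`. -/
def toComplex (q : ℝ × ℝ) : ℂ × ℂ := ((q.1 : ℂ), (q.2 : ℂ))

/-- The real section `A ∩ ℝ²` of a subset `A` of `ℂ²`. -/
def realSection (A : Set (ℂ × ℂ)) : Set (ℝ × ℝ) := {q | toComplex q ∈ A}

/-- The fixed point `p₊ = (1/2, 1/2)`. -/
noncomputable def pPlus : ℝ × ℝ := (1 / 2, 1 / 2)

/-- The fixed point `p₋ = (-1/2, -1/2)`. -/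
noncomputable def pMinus : ℝ × ℝ := (-1 / 2, -1 / 2)

/-- The point `p = (-√5/2, √5/2)` of the saddle cycle of period two. -/
noncomputable def p : ℝ × ℝ := (-(√5 / 2), √5 / 2)

/-- The point `p' = (√5/2, -√5/2)` of the saddle cycle of period two. -/
noncomputable def p' : ℝ × ℝ := (√5 / 2, -(√5 / 2))

/-- The basin in `ℂ²` of a fixed point `a` of `f`: all points whose forward orbit converges
to `a`. -/
def complexBasin (a : ℂ × ℂ) : Set (ℂ × ℂ) :=
  {z | Tendsto (fun n : ℕ => (f ℂ)^[n] z) atTop (𝓝 a)}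

/-- The real basin `Ω₊`: the real section of the basin of `p₊` in `ℂ²`. -/
def basinPlus : Set (ℝ × ℝ) := realSection (complexBasin (toComplex pPlus))

/-- The real basin `Ω₋`: the real section of the basin of `p₋` in `ℂ²`. -/
def basinMinus : Set (ℝ × ℝ) := realSection (complexBasin (toComplex pMinus))

/-- The real stable set `W^s(A)` of a nonempty finite set `A ⊆ ℝ²`: the points `q` of `ℝ²` with
`d(fⁿ(q), A) → 0`. (All norms on `ℝ²` are equivalent, so the maximum metric of `ℝ × ℝ` gives the
same set as the Euclidean metric.) -/
def stableSet (A : Set (ℝ × ℝ)) : Set (ℝ × ℝ) :=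
  {q | Tendsto (fun n : ℕ => Metric.infDist ((f ℝ)^[n] q) A) atTop (𝓝 0)}

/-- The forward filled Julia set `K⁺ ⊆ ℂ²`: the points with bounded forward orbit. -/
def KPlus : Set (ℂ × ℂ) :=
  {z | Bornology.IsBounded (Set.range fun n : ℕ => (f ℂ)^[n] z)}

/-- The forward Julia set `J⁺ = ∂K⁺`, the boundary being taken in `ℂ²`. -/
def JPlus : Set (ℂ × ℂ) := frontier KPlus

/-- The real forward Julia set `J⁺_ℝ = J⁺ ∩ ℝ²`. -/
def realJPlus : Set (ℝ × ℝ) := realSection JPlus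

end BieberbachMap

namespace BieberbachMap

/-! ### Two-step recursive inequalities -/

/-! The map turns into the second-order recurrence y (n+2) = y n / 2 + (3/4 y (n+1) - y (n+1)^3) on
first coordinates. A real orbit either keeps a constant sign, and then tends to ±1/2 or 0, or at
some time has two consecutive terms with product ≤ 0. From then on, a n = ±(-1)^n y n is followed.
While it stays nonnegative it tends to 0, tends to √5/2 (the 2-cycle) or escapes; if its sign
breaks, the orbit has entered a quadrant absorbed by 1/2 or -1/2. This is `IsOrbit.classification`.

Both basins are open, as is the escaping set, and they are pairwise disjoint. Hence the frontier of
either basin, and the real part of `frontier KPlus`, can only meet the remaining class, the two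
stable sets.

Conversely, invariance under the homeomorphism f allows replacing a point of a stable set by a late
iterate, whose orbit stays near the saddle. Near 0, a positive diagonal displacement is amplified
until the orbit falls to 1/2 (`IsOrbit.tendsto_half_of_lt`), and symmetry gives -1/2. Near the
cycle, a one-parameter displacement and the intermediate value theorem yield orbits whose
alternation breaks at times of either parity, and the parity decides the basin
(`exists_near_of_altCoord`). For J⁺, derivatives of the iterates along a real direction grow
geometrically, whereas Cauchy's estimate would bound them at an interior point of K⁺
(`notMem_interior_KPlus`). -/

theorem tendsto_zero_of_le_mul_max {s : ℕ → ℝ} {ρ : ℝ} (hs : ∀ n, 0 ≤ s n) (h0 : 0 ≤ ρ)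
    (h1 : ρ < 1) (h : ∀ n, s (n + 2) ≤ ρ * max (s n) (s (n + 1))) :
    Tendsto s atTop (𝓝 0) := by
  set M := max (s 0) (s 1)
  have hM : 0 ≤ M := (hs 0).trans (le_max_left _ _)
  -- A factor ρ is gained only once every two indices, so terms are treated in blocks {2n, 2n+1}.
  have key : ∀ n, s (2 * n) ≤ ρ ^ n * M ∧ s (2 * n + 1) ≤ ρ ^ n * M := by
    intro n
    induction n with
    | zero => simp [M]
    | succ n ih =>
      have hle : ρ ^ (n + 1) * M ≤ ρ ^ n * M :=
        mul_le_mul_of_nonneg_right (pow_le_pow_of_le_one h0 h1.le n.le_succ) hM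
      have e1 : s (2 * n + 2) ≤ ρ ^ (n + 1) * M := calc
        _ ≤ ρ * max (s (2 * n)) (s (2 * n + 1)) := h _
        _ ≤ ρ * (ρ ^ n * M) := mul_le_mul_of_nonneg_left (max_le ih.1 ih.2) h0
        _ = _ := by ring
      have e2 : s (2 * n + 1 + 2) ≤ ρ ^ (n + 1) * M := calc
        _ ≤ ρ * max (s (2 * n + 1)) (s (2 * n + 1 + 1)) := h _
        _ ≤ ρ * (ρ ^ n * M) := mul_le_mul_of_nonneg_left (max_le ih.2 (e1.trans hle)) h0
        _ = _ := by ring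
      exact ⟨e1, e2⟩
  have hle : ∀ n, s n ≤ ρ ^ (n / 2) * M := by
    intro n
    rcases Nat.even_or_odd' n with ⟨k, rfl | rfl⟩
    · have : 2 * k / 2 = k := by omega
      rw [this]; exact (key k).1
    · have : (2 * k + 1) / 2 = k := by omega
      rw [this]; exact (key k).2
  have hlim : Tendsto (fun n : ℕ => ρ ^ (n / 2) * M) atTop (𝓝 0) := by
    have := ((tendsto_pow_atTop_nhds_zero_of_lt_one h0 h1).comp
      (Nat.tendsto_div_const_atTop (two_ne_zero))).mul_const M
    simpa using this
  exact squeeze_zero hs hle hlim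

/-- Expanding counterpart of the contraction lemma: block minima grow by the factor r until capped
at B. The cap lets expansion be assumed only below the level B. -/
theorem eventually_ge_of_min_le {s : ℕ → ℝ} {B r : ℝ} (hB : 0 < B) (hr : 1 < r) (h0 : 0 < s 0)
    (h1 : 0 < s 1) (h : ∀ n, min B (r * min (s n) (s (n + 1))) ≤ s (n + 2)) :
    ∃ N, ∀ n ≥ N, B ≤ s n := by
  set m := min (s 0) (s 1)
  have hm : 0 < m := lt_min h0 h1
  have hrm : ∀ n : ℕ, min B (r ^ n * m) ≤ min B (r ^ (n + 1) * m) := fun n =>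
    min_le_min_left _ (mul_le_mul_of_nonneg_right (pow_le_pow_right₀ hr.le n.le_succ) hm.le)
  have step : ∀ (n : ℕ) (x y : ℝ), min B (r ^ n * m) ≤ x → min B (r ^ n * m) ≤ y →
      min B (r ^ (n + 1) * m) ≤ min B (r * min x y) := by
    intro n x y hx hy
    refine le_min (min_le_left _ _) ?_
    have h2 : min B (r ^ n * m) ≤ min x y := le_min hx hy
    have h3 : r * min B (r ^ n * m) ≤ r * min x y := mul_le_mul_of_nonneg_left h2 (by linarith)
    refine le_trans ?_ h3
    rcases le_total B (r ^ n * m) with h4 | h4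
    · rw [min_eq_left h4]
      exact (min_le_left _ _).trans (by nlinarith)
    · rw [min_eq_right h4]
      refine (min_le_right _ _).trans (le_of_eq (by ring))
  have key : ∀ n, min B (r ^ n * m) ≤ s (2 * n) ∧ min B (r ^ n * m) ≤ s (2 * n + 1) := by
    intro n
    induction n with
    | zero => simp [m]
    | succ n ih =>
      have e1 : min B (r ^ (n + 1) * m) ≤ s (2 * n + 2) := (step n _ _ ih.1 ih.2).trans (h _)
      have e2 : min B (r ^ (n + 1) * m) ≤ s (2 * n + 1 + 2) :=
        (step n _ _ ih.2 ((hrm n).trans e1)).trans (h _)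
      exact ⟨e1, e2⟩
  obtain ⟨k, hk⟩ := pow_unbounded_of_one_lt (B / m) hr
  have hmono : ∀ n ≥ k, min B (r ^ n * m) = B := by
    intro n hn
    refine min_eq_left ?_
    have h2 : r ^ k ≤ r ^ n := pow_le_pow_right₀ hr.le hn
    rw [div_lt_iff₀ hm] at hk
    nlinarith
  refine ⟨2 * k, fun n hn => ?_⟩
  rcases Nat.even_or_odd' n with ⟨j, rfl | rfl⟩
  · rw [← hmono j (by omega)]; exact (key j).1
  · rw [← hmono j (by omega)]; exact (key j).2

/-! ### Orbits as solutions of a second-order recurrence -/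

/-- The sequences of first coordinates of orbits of `f`. -/
def IsOrbit {𝕜 : Type*} [Field 𝕜] (y : ℕ → 𝕜) : Prop :=
  ∀ n, y (n + 2) = y n / 2 - y (n + 1) ^ 3 + 3 / 4 * y (n + 1)

/-- The recurrence satisfied by `(-1) ^ n * y n` for an orbit `y`. -/
def IsAltOrbit (a : ℕ → ℝ) : Prop :=
  ∀ n, a (n + 2) = a n / 2 + a (n + 1) ^ 3 - 3 / 4 * a (n + 1)

theorem IsOrbit.shift {𝕜 : Type*} [Field 𝕜] {y : ℕ → 𝕜} (h : IsOrbit y) (N : ℕ) :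
    IsOrbit fun n => y (n + N) := by
  intro n
  have := h (n + N)
  simp only [show n + 2 + N = n + N + 2 by omega, show n + 1 + N = n + N + 1 by omega, this]

theorem IsOrbit.neg {𝕜 : Type*} [Field 𝕜] {y : ℕ → 𝕜} (h : IsOrbit y) :
    IsOrbit fun n => -y n := by
  intro n
  simp only [h n]
  ring

theorem IsAltOrbit.shift {a : ℕ → ℝ} (h : IsAltOrbit a) (N : ℕ) :
    IsAltOrbit fun n => a (n + N) := by
  intro n
  have := h (n + N)
  simp only [show n + 2 + N = n + N + 2 by omega, show n + 1 + N = n + N + 1 by omega, this]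

theorem IsOrbit.alt {y : ℕ → ℝ} (h : IsOrbit y) : IsAltOrbit fun n => (-1) ^ n * y n := by
  intro n
  have h1 : ((-1 : ℝ) ^ n) ^ 2 = 1 := by rw [← pow_mul, mul_comm, pow_mul]; simp
  have h3 : ((-1 : ℝ) ^ n) ^ 3 = (-1) ^ n := by rw [pow_succ, h1, one_mul]
  simp only [h n, pow_succ (-1 : ℝ), mul_pow, h3]
  ring_nf

/-- The cubic 3/4 y - y^3 has a critical point at 1/2, so a deviation v there enters only as v^2
(3/2 + v). On the disc of radius 1/5 the two coefficients are 1/2 and 17/50, with sum 42/50 < 1. -/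
theorem IsOrbit.tendsto_half {y : ℕ → ℂ} (h : IsOrbit y) (h0 : ‖y 0 - 1 / 2‖ ≤ 1 / 5)
    (h1 : ‖y 1 - 1 / 2‖ ≤ 1 / 5) : Tendsto y atTop (𝓝 (1 / 2)) := by
  have step : ∀ n, ‖y (n + 1) - 1 / 2‖ ≤ 1 / 5 →
      ‖y (n + 2) - 1 / 2‖ ≤ ‖y n - 1 / 2‖ / 2 + 17 / 50 * ‖y (n + 1) - 1 / 2‖ := by
    intro n hn
    have e : y (n + 2) - 1 / 2 = (y n - 1 / 2) / 2 -
        (y (n + 1) - 1 / 2) * ((y (n + 1) - 1 / 2) * (3 / 2 + (y (n + 1) - 1 / 2))) := by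
      rw [h n]; ring
    set v := y (n + 1) - 1 / 2
    have hv : ‖v * (3 / 2 + v)‖ ≤ 17 / 50 := by
      rw [norm_mul]
      have : ‖(3 / 2 : ℂ) + v‖ ≤ 17 / 10 := by
        refine (norm_add_le _ _).trans ?_
        have : ‖(3 / 2 : ℂ)‖ = 3 / 2 := by norm_num
        linarith
      calc _ ≤ (1 / 5 : ℝ) * (17 / 10) := mul_le_mul hn this (norm_nonneg _) (by norm_num)
        _ = _ := by norm_num
    rw [e]
    refine (norm_sub_le _ _).trans ?_
    rw [norm_div, norm_mul v]
    have : ‖(2 : ℂ)‖ = 2 := by norm_num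
    rw [this]
    nlinarith [norm_nonneg v]
  have small : ∀ n, ‖y n - 1 / 2‖ ≤ 1 / 5 ∧ ‖y (n + 1) - 1 / 2‖ ≤ 1 / 5 := by
    intro n
    induction n with
    | zero => exact ⟨h0, h1⟩
    | succ n ih =>
      refine ⟨ih.2, (step n ih.2).trans ?_⟩
      linarith [ih.1, ih.2]
  rw [tendsto_iff_norm_sub_tendsto_zero]
  refine tendsto_zero_of_le_mul_max (ρ := 42 / 50) (fun n => norm_nonneg _) (by norm_num)
    (by norm_num) fun n => (step n (small n).2).trans ?_
  linarith [le_max_left ‖y n - 1 / 2‖ ‖y (n + 1) - 1 / 2‖,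
    le_max_right ‖y n - 1 / 2‖ ‖y (n + 1) - 1 / 2‖]

theorem IsOrbit.ofReal {y : ℕ → ℝ} (h : IsOrbit y) : IsOrbit fun n => (y n : ℂ) := by
  intro n
  simp only [h n]
  push_cast
  ring

theorem IsOrbit.tendsto_half_real {y : ℕ → ℝ} (h : IsOrbit y) (h0 : |y 0 - 1 / 2| ≤ 1 / 5)
    (h1 : |y 1 - 1 / 2| ≤ 1 / 5) : Tendsto y atTop (𝓝 (1 / 2)) := by
  have key : ∀ x : ℝ, ‖(x : ℂ) - 1 / 2‖ = |x - 1 / 2| := by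
    intro x
    rw [← Real.norm_eq_abs, ← Complex.norm_real]
    push_cast
    rfl
  have := h.ofReal.tendsto_half (by rw [key]; exact h0) (by rw [key]; exact h1)
  have h2 := (Complex.continuous_re.tendsto _).comp this
  simpa [Function.comp_def] using h2

theorem tendsto_of_shift {α : Type*} {y : ℕ → α} {l : Filter α} (N : ℕ)
    (h : Tendsto (fun n => y (n + N)) atTop l) : Tendsto y atTop l :=
  (tendsto_add_atTop_iff_nat N).1 h

/-- Orbits entering the positive quadrant below height `√3 / 2` converge to `1 / 2`. -/
theorem IsOrbit.tendsto_half_of_quadrant {y : ℕ → ℝ} (h : IsOrbit y) (h0 : 0 ≤ y 0) (h1 : 0 ≤ y 1)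
    (hs0 : y 0 ^ 2 < 3 / 4) (hs1 : y 1 ^ 2 < 3 / 4) (hne : 0 < y 0 ∨ 0 < y 1) :
    Tendsto y atTop (𝓝 (1 / 2)) := by
  -- 1/4 - 3/4 y + y^3 = (y - 1/2)^2 (y + 1); the same identity bounds the cubic throughout.
  have cub : ∀ n, 0 ≤ y n → 3 / 4 * y n - y n ^ 3 ≤ 1 / 4 := fun n hn => by
    nlinarith [mul_nonneg (sq_nonneg (y n - 1 / 2)) (by linarith : 0 ≤ y n + 1)]
  have inv : ∀ n, (0 ≤ y n ∧ y n ^ 2 < 3 / 4) ∧ (0 ≤ y (n + 1) ∧ y (n + 1) ^ 2 < 3 / 4) ∧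
      (0 < y n ∨ 0 < y (n + 1)) := by
    intro n
    induction n with
    | zero => exact ⟨⟨h0, hs0⟩, ⟨h1, hs1⟩, hne⟩
    | succ n ih =>
      obtain ⟨⟨a0, a1⟩, ⟨b0, b1⟩, c⟩ := ih
      have hh : 0 ≤ y (n + 1) * (3 / 4 - y (n + 1) ^ 2) := mul_nonneg b0 (by linarith)
      have e := h n
      have hle : y n ≤ 7 / 8 := by nlinarith
      have := cub _ b0
      have hn2 : 0 ≤ y (n + 2) := by nlinarith
      refine ⟨⟨b0, b1⟩, ⟨hn2, ?_⟩, ?_⟩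
      · have : y (n + 2) ≤ 7 / 10 := by nlinarith
        show y (n + 2) ^ 2 < 3 / 4
        nlinarith
      · rcases c with c | c
        · right
          show 0 < y (n + 2)
          nlinarith
        · exact Or.inl c
  have pos : ∀ n, 0 < y (n + 2) := by
    intro n
    obtain ⟨⟨a0, a1⟩, ⟨b0, b1⟩, c⟩ := inv n
    have e := h n
    rcases c with c | c
    · nlinarith [mul_nonneg b0 (by linarith : 0 ≤ 3 / 4 - y (n + 1) ^ 2)]
    · nlinarith [mul_pos c (by linarith : 0 < 3 / 4 - y (n + 1) ^ 2)]
  have upper : ∀ n, y (n + 2) ≤ 7 / 10 := by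
    intro n
    obtain ⟨⟨a0, a1⟩, ⟨b0, b1⟩, c⟩ := inv n
    have hle : y n ≤ 7 / 8 := by nlinarith
    have := cub _ b0
    linarith [h n]
  -- The target [3/10, 7/10] is the trapping interval of radius 1/5 about 1/2. Below 3/10 the cubic
  -- is at least 3/5 b, whence r = 1/2 + 3/5; on [3/10, 7/10] it is at least 9/50.
  obtain ⟨N, hN⟩ := eventually_ge_of_min_le (s := fun n => y (n + 2)) (B := 3 / 10) (r := 11 / 10)
    (by norm_num) (by norm_num) (pos 0) (pos 1) (by
      intro n
      have e := h (n + 2)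
      have p0 := pos n
      have p1 := pos (n + 1)
      have u0 := upper n
      have u1 := upper (n + 1)
      show _ ≤ y (n + 2 + 2)
      rw [e, min_le_iff]
      simp only [show n + 1 + 2 = n + 2 + 1 by omega] at p1 u1 ⊢
      set a := y (n + 2)
      set b := y (n + 2 + 1)
      rcases le_total b (3 / 10) with hb | hb
      · right
        have : 3 / 5 * b ≤ 3 / 4 * b - b ^ 3 := by
          nlinarith [mul_nonneg p1.le (by nlinarith : 0 ≤ 3 / 20 - b ^ 2)]
        linarith [min_le_left a b, min_le_right a b]
      · have h3 : 9 / 50 ≤ 3 / 4 * b - b ^ 3 := by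
          nlinarith [mul_nonneg (mul_nonneg (sub_nonneg.2 hb) (sub_nonneg.2 u1)) p1.le,
            mul_nonneg (sub_nonneg.2 hb) (sub_nonneg.2 u1)]
        rcases le_total a (3 / 10) with ha | ha
        · right
          linarith [min_le_left a b, min_le_right a b]
        · left
          linarith)
  refine tendsto_of_shift (N + 2) ((h.shift (N + 2)).tendsto_half_real ?_ ?_)
  · rw [abs_le]
    have h1 := hN N le_rfl
    have h2 := upper N
    simp only [Nat.zero_add] at *
    constructor <;> linarith
  · rw [abs_le]
    have h1 := hN (N + 1) (by omega)
    have h2 := upper (N + 1)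
    simp only [show 1 + (N + 2) = N + 1 + 2 by omega] at *
    constructor <;> linarith

theorem IsOrbit.tendsto_zero_of_zero {y : ℕ → ℝ} (h : IsOrbit y) (h0 : y 0 = 0) (h1 : y 1 = 0) :
    Tendsto y atTop (𝓝 0) := by
  have : ∀ n, y n = 0 ∧ y (n + 1) = 0 := by
    intro n
    induction n with
    | zero => exact ⟨h0, h1⟩
    | succ n ih => exact ⟨ih.2, by rw [h n, ih.1, ih.2]; norm_num⟩
  have e : y = fun _ => 0 := funext fun n => (this n).1
  rw [e]
  exact tendsto_const_nhds

/-- The cubic is at most 1/4 on nonnegative reals, so the excess over 1/2 is at least halved every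
two steps. The orbit thus enters the quadrant region below √3/2, unless two consecutive terms
vanish. -/
theorem IsOrbit.tendsto_of_nonneg {y : ℕ → ℝ} (h : IsOrbit y) (hpos : ∀ n, 0 ≤ y n) :
    Tendsto y atTop (𝓝 (1 / 2)) ∨ Tendsto y atTop (𝓝 0) := by
  have hs : Tendsto (fun n => max (y n - 1 / 2) 0) atTop (𝓝 0) := by
    refine tendsto_zero_of_le_mul_max (ρ := 1 / 2) (fun n => le_max_right _ _) (by norm_num)
      (by norm_num) fun n => max_le ?_ ?_
    · have := hpos (n + 1)
      have hc : 3 / 4 * y (n + 1) - y (n + 1) ^ 3 ≤ 1 / 4 := by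
        nlinarith [mul_nonneg (sq_nonneg (y (n + 1) - 1 / 2)) (by linarith : 0 ≤ y (n + 1) + 1)]
      have := le_max_left (max (y n - 1 / 2) 0) (max (y (n + 1) - 1 / 2) 0)
      have := le_max_left (y n - 1 / 2) 0
      linarith [h n]
    · have := le_max_left (max (y n - 1 / 2) 0) (max (y (n + 1) - 1 / 2) 0)
      have := le_max_right (y n - 1 / 2) 0
      linarith
  obtain ⟨N, hN⟩ := eventually_atTop.1 (hs.eventually (gt_mem_nhds (by norm_num : (0 : ℝ) < 1 / 5)))
  have bd : ∀ n ≥ N, y n ≤ 7 / 10 := fun n hn => by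
    have := hN n hn
    have := le_max_left (y n - 1 / 2) 0
    linarith
  have sq : ∀ n ≥ N, y n ^ 2 < 3 / 4 := fun n hn => by nlinarith [bd n hn, hpos n]
  by_cases hz : y N = 0 ∧ y (N + 1) = 0
  · right
    refine tendsto_of_shift N ((h.shift N).tendsto_zero_of_zero ?_ ?_)
    · simpa using hz.1
    · simpa [add_comm] using hz.2
  · left
    refine tendsto_of_shift N ((h.shift N).tendsto_half_of_quadrant (hpos _) (hpos _)
      (sq _ (by omega)) (sq _ (by omega)) ?_)
    by_contra hcon
    push Not at hcon
    refine hz ⟨?_, ?_⟩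
    · exact le_antisymm (by simpa using hcon.1) (hpos _)
    · exact le_antisymm (by simpa [add_comm] using hcon.2) (hpos _)

/-! ### Classification of real orbits -/

theorem sqrt_five_div_two_sq : (√5 / 2) ^ 2 = 5 / 4 := by
  rw [div_pow, Real.sq_sqrt (by norm_num)]; norm_num

theorem sqrt_five_div_two_pos : 0 < √5 / 2 := by positivity

/-- The cubic term is (a^2 - 3/4) a, and a^2 - 3/4 = 1/2 exactly at √5/2. Below this level the two
coefficients sum to less than 1; above it, to more than 1, which gives the escape lemma. -/
theorem IsAltOrbit.tendsto_zero_of_lt {a : ℕ → ℝ} (h : IsAltOrbit a) (hpos : ∀ n, 0 ≤ a n)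
    (h0 : a 0 < √5 / 2) (h1 : a 1 < √5 / 2) : Tendsto a atTop (𝓝 0) := by
  set M := max (a 0) (a 1)
  have hM : M < √5 / 2 := max_lt h0 h1
  have hM0 : 0 ≤ M := (hpos 0).trans (le_max_left _ _)
  set ρ := max (M ^ 2 - 3 / 4) 0
  have hρ0 : 0 ≤ ρ := le_max_right _ _
  have hρ : ρ < 1 / 2 := by
    refine max_lt ?_ (by norm_num)
    nlinarith [sqrt_five_div_two_sq]
  have step : ∀ n, a (n + 1) ≤ M → a (n + 2) ≤ (1 / 2 + ρ) * max (a n) (a (n + 1)) := by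
    intro n hn
    have hb := hpos (n + 1)
    have h3 : a (n + 1) ^ 2 - 3 / 4 ≤ ρ := by
      refine le_trans ?_ (le_max_left _ _)
      nlinarith
    have h4 : a (n + 1) * (a (n + 1) ^ 2 - 3 / 4) ≤ ρ * max (a n) (a (n + 1)) := by
      calc _ ≤ a (n + 1) * ρ := mul_le_mul_of_nonneg_left h3 hb
        _ = ρ * a (n + 1) := mul_comm _ _
        _ ≤ _ := mul_le_mul_of_nonneg_left (le_max_right _ _) hρ0
    have := le_max_left (a n) (a (n + 1))
    rw [h n]
    linarith
  have bd : ∀ n, a n ≤ M ∧ a (n + 1) ≤ M := by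
    intro n
    induction n with
    | zero => exact ⟨le_max_left _ _, le_max_right _ _⟩
    | succ n ih =>
      refine ⟨ih.2, (step n ih.2).trans ?_⟩
      have := max_le ih.1 ih.2
      nlinarith [(hpos n).trans (le_max_left (a n) (a (n + 1)))]
  exact tendsto_zero_of_le_mul_max hpos (by linarith) (by linarith) fun n => step n (bd n).2

theorem IsAltOrbit.escape_of_gt {a : ℕ → ℝ} (h : IsAltOrbit a)
    (h0 : √5 / 2 < a 0) (h1 : √5 / 2 < a 1) : ∃ n, 2 < a (n + 1) ∧ a n ≤ a (n + 1) := by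
  set m := min (a 0) (a 1)
  have hc := sqrt_five_div_two_pos
  have hm : √5 / 2 < m := lt_min h0 h1
  have hρ : 1 / 2 < m ^ 2 - 3 / 4 := by nlinarith [sqrt_five_div_two_sq]
  have step : ∀ n, m ≤ a n → m ≤ a (n + 1) →
      (1 / 2 + (m ^ 2 - 3 / 4)) * min (a n) (a (n + 1)) ≤ a (n + 2) := by
    intro n hn hn1
    have h3 : (m ^ 2 - 3 / 4) * min (a n) (a (n + 1)) ≤ (a (n + 1) ^ 2 - 3 / 4) * a (n + 1) := by
      refine mul_le_mul ?_ (min_le_right _ _) ((hc.trans hm).le.trans (le_min hn hn1)) ?_ <;> nlinarith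
    have := min_le_left (a n) (a (n + 1))
    rw [h n]
    linarith
  have bd : ∀ n, m ≤ a n ∧ m ≤ a (n + 1) := by
    intro n
    induction n with
    | zero => exact ⟨min_le_left _ _, min_le_right _ _⟩
    | succ n ih =>
      refine ⟨ih.2, le_trans ?_ (step n ih.1 ih.2)⟩
      have := le_min ih.1 ih.2
      nlinarith
  obtain ⟨N, hN⟩ := eventually_ge_of_min_le (s := a) (B := 3) (by norm_num)
    (by linarith : 1 < 1 / 2 + (m ^ 2 - 3 / 4)) (hc.trans h0) (hc.trans h1)
    fun n => (min_le_right _ _).trans (step n (bd n).1 (bd n).2)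
  have hb := hN (N + 1) (by omega)
  have ha := hN N le_rfl
  have e := h N
  refine ⟨N + 1, ?_, ?_⟩
  · show 2 < a (N + 2)
    nlinarith [mul_nonneg (sub_nonneg.2 hb) (sq_nonneg (a (N + 1)))]
  · show _ ≤ a (N + 2)
    nlinarith [mul_nonneg (sub_nonneg.2 hb) (sq_nonneg (a (N + 1)))]

/-- If no two consecutive terms lie strictly on the same side of √5/2, the terms straddle it. Then a
n and a (n+2) lie on one side while a (n+1) pulls towards the other, so the distance to √5/2 is at
least halved every two steps. -/
theorem IsAltOrbit.trichotomy_of_nonneg {a : ℕ → ℝ} (h : IsAltOrbit a) (hpos : ∀ n, 0 ≤ a n) :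
    Tendsto a atTop (𝓝 0) ∨ Tendsto a atTop (𝓝 (√5 / 2)) ∨
      ∃ n, 2 < a (n + 1) ∧ a n ≤ a (n + 1) := by
  by_cases hlt : ∃ n, a n < √5 / 2 ∧ a (n + 1) < √5 / 2
  · obtain ⟨N, h0, h1⟩ := hlt
    refine Or.inl (tendsto_of_shift N ((h.shift N).tendsto_zero_of_lt (fun n => hpos _) ?_ ?_))
    · simpa using h0
    · simpa [add_comm] using h1
  by_cases hgt : ∃ n, √5 / 2 < a n ∧ √5 / 2 < a (n + 1)
  · obtain ⟨N, h0, h1⟩ := hgt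
    obtain ⟨n, hn⟩ := (h.shift N).escape_of_gt (by simpa using h0) (by simpa [add_comm] using h1)
    refine Or.inr (Or.inr ⟨n + N, ?_⟩)
    simpa only [show n + 1 + N = n + N + 1 by omega] using hn
  push Not at hlt hgt
  right; left
  rw [tendsto_iff_norm_sub_tendsto_zero]
  have hc := sqrt_five_div_two_pos
  have hc2 := sqrt_five_div_two_sq
  refine tendsto_zero_of_le_mul_max (ρ := 1 / 2) (fun n => norm_nonneg _) (by norm_num)
    (by norm_num) fun n => ?_
  refine le_trans ?_ (mul_le_mul_of_nonneg_left (le_max_left _ _) (by norm_num))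
  have e := h n
  have hb := hpos (n + 1)
  simp only [Real.norm_eq_abs]
  have l0 := hlt n
  have l1 := hlt (n + 1)
  have g0 := hgt n
  have g1 := hgt (n + 1)
  simp only [show n + 1 + 1 = n + 2 by omega] at l1 g1
  set c := √5 / 2
  rcases lt_trichotomy (a (n + 1)) c with hlt' | heq | hgt'
  · have h2 := l1 hlt'
    have h0 : c ≤ a n := by
      by_contra hcon
      exact absurd (l0 (not_le.1 hcon)) (not_le.2 hlt')
    rw [abs_of_nonneg (by linarith), abs_of_nonneg (by linarith)]
    nlinarith [mul_nonneg hb (by nlinarith : 0 ≤ 5 / 4 - a (n + 1) ^ 2)]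
  · have : a (n + 2) - c = 1 / 2 * (a n - c) := by
      rw [e, heq]
      have : c ^ 3 = 5 / 4 * c := by rw [pow_succ, hc2]
      linarith
    rw [this, abs_mul]
    norm_num
  · have h2 := g1 hgt'
    have h0 : a n ≤ c := by
      by_contra hcon
      exact absurd (g0 (not_le.1 hcon)) (not_le.2 hgt')
    rw [abs_of_nonpos (by linarith), abs_of_nonpos (by linarith)]
    nlinarith [mul_nonneg hb (by nlinarith : 0 ≤ a (n + 1) ^ 2 - 5 / 4)]

theorem IsOrbit.sign_mul {y : ℕ → ℝ} (h : IsOrbit y) {t : ℝ} (ht : t = 1 ∨ t = -1) :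
    IsOrbit fun n => t * y n := by
  rcases ht with rfl | rfl
  · simpa using h
  · simpa using h.neg

/-- An alternating orbit whose first coordinate breaks the sign pattern at time `m + 2` converges
to the fixed point lying in the quadrant it has entered. -/
theorem IsOrbit.tendsto_half_of_alt_entry {y : ℕ → ℝ} (h : IsOrbit y) {s : ℝ}
    (hs : s = 1 ∨ s = -1) {m : ℕ} (h0 : 0 ≤ s * ((-1) ^ m * y m))
    (h1 : 0 ≤ s * ((-1) ^ (m + 1) * y (m + 1))) (h2 : s * ((-1) ^ (m + 2) * y (m + 2)) < 0) :
    Tendsto (fun n => s * (-1) ^ (m + 1) * y n) atTop (𝓝 (1 / 2)) := by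
  obtain ⟨t, ht, hst⟩ : ∃ t : ℝ, (t = 1 ∨ t = -1) ∧ s * (-1) ^ (m + 1) = t := by
    refine ⟨_, ?_, rfl⟩
    rcases hs with rfl | rfl <;> rcases neg_one_pow_eq_or ℝ (m + 1) with e | e <;> simp [e]
  have e0 : s * ((-1) ^ m * y m) = -(t * y m) := by rw [← hst]; ring
  have e1 : s * ((-1) ^ (m + 1) * y (m + 1)) = t * y (m + 1) := by rw [← hst]; ring
  have e2 : s * ((-1) ^ (m + 2) * y (m + 2)) = -(t * y (m + 2)) := by rw [← hst]; ring
  rw [e0] at h0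
  rw [e1] at h1
  rw [e2] at h2
  rw [hst]
  have hz := h.sign_mul ht
  have e := hz m
  simp only at e
  set z := fun n => t * y n
  have g0 : z m ≤ 0 := by show t * y m ≤ 0; linarith
  have g1 : 0 ≤ z (m + 1) := h1
  have g2 : 0 < z (m + 2) := by show 0 < t * y (m + 2); linarith
  replace e : z (m + 2) = z m / 2 - z (m + 1) ^ 3 + 3 / 4 * z (m + 1) := hz m
  -- As z m ≤ 0, positivity of z (m+2) must come from the cubic term, which is positive only below
  -- √3/2.
  have hsq : z (m + 1) ^ 2 < 3 / 4 := by
    by_contra hcon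
    push Not at hcon
    nlinarith [mul_nonneg g1 (sub_nonneg.2 hcon)]
  have hle : z (m + 2) ≤ 1 / 4 := by
    nlinarith [mul_nonneg (sq_nonneg (z (m + 1) - 1 / 2)) (by linarith : 0 ≤ z (m + 1) + 1)]
  refine tendsto_of_shift (m + 1) ((hz.shift (m + 1)).tendsto_half_of_quadrant ?_ ?_ ?_ ?_ ?_)
  · simpa using g1
  · simpa only [show 1 + (m + 1) = m + 2 by omega] using g2.le
  · simpa using hsq
  · simp only [show 1 + (m + 1) = m + 2 by omega]
    show z (m + 2) ^ 2 < 3 / 4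
    nlinarith
  · right
    simpa only [show 1 + (m + 1) = m + 2 by omega] using g2

/-- The limit depends on the parity of the time at which the alternation breaks; this is what
separates the basins near the cycle. -/
theorem IsOrbit.tendsto_of_alt_entry {y : ℕ → ℝ} (h : IsOrbit y) {s : ℝ}
    (hs : s = 1 ∨ s = -1) {m : ℕ} (h0 : 0 ≤ s * ((-1) ^ m * y m))
    (h1 : 0 ≤ s * ((-1) ^ (m + 1) * y (m + 1))) (h2 : s * ((-1) ^ (m + 2) * y (m + 2)) < 0) :
    Tendsto y atTop (𝓝 (s * (-1) ^ (m + 1) / 2)) := by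
  have key := (h.tendsto_half_of_alt_entry hs h0 h1 h2).const_mul (s * (-1) ^ (m + 1))
  have e : (s * (-1) ^ (m + 1)) * (s * (-1) ^ (m + 1)) = 1 := by
    rcases hs with rfl | rfl <;> rcases neg_one_pow_eq_or ℝ (m + 1) with e | e <;> simp [e]
  simp only [← mul_assoc] at key e
  simp only [e, one_mul] at key
  convert key using 2
  ring

/-- The asymptotic behaviour of real orbits. -/
theorem IsOrbit.classification {y : ℕ → ℝ} (h : IsOrbit y) :
    Tendsto y atTop (𝓝 (1 / 2)) ∨ Tendsto y atTop (𝓝 (-1 / 2)) ∨ Tendsto y atTop (𝓝 0) ∨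
      (∃ s : ℝ, (s = 1 ∨ s = -1) ∧
        Tendsto (fun n => s * ((-1) ^ n * y n)) atTop (𝓝 (√5 / 2))) ∨
      ∃ n, 2 < |y (n + 1)| ∧ |y n| ≤ |y (n + 1)| := by
  -- In the first case the alternating sequence is followed from N until its sign breaks, if ever;
  -- in the second all terms have one strict sign.
  by_cases hprod : ∃ N, y N * y (N + 1) ≤ 0
  · obtain ⟨N, hN⟩ := hprod
    obtain ⟨s, hs, hs0, hs1⟩ : ∃ s : ℝ, (s = 1 ∨ s = -1) ∧ 0 ≤ s * ((-1) ^ N * y N) ∧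
        0 ≤ s * ((-1) ^ (N + 1) * y (N + 1)) := by
      have key : ∀ u v : ℝ, u * v ≤ 0 → ∃ s : ℝ, (s = 1 ∨ s = -1) ∧ 0 ≤ s * u ∧ s * v ≤ 0 := by
        intro u v huv
        rcases mul_nonpos_iff.1 huv with h' | h'
        · exact ⟨1, Or.inl rfl, by simpa using h'.1, by simpa using h'.2⟩
        · exact ⟨-1, Or.inr rfl, by simpa using h'.1, by simpa using h'.2⟩
      have h2 : ((-1 : ℝ) ^ N) * ((-1) ^ N) = 1 := by
        rcases neg_one_pow_eq_or ℝ N with e | e <;> simp [e]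
      obtain ⟨s, hs, hu, hv⟩ := key ((-1) ^ N * y N) ((-1) ^ N * y (N + 1)) (by
        calc _ = ((-1 : ℝ) ^ N) * ((-1) ^ N) * (y N * y (N + 1)) := by ring
          _ ≤ 0 := by rw [h2]; linarith)
      refine ⟨s, hs, hu, ?_⟩
      rw [pow_succ]
      linarith
    have hb : IsAltOrbit fun n => s * ((-1) ^ n * y n) := by
      have e : (fun n => s * ((-1) ^ n * y n)) = fun n => (-1) ^ n * (s * y n) := by
        funext n
        ring
      rw [e]
      exact (h.sign_mul hs).alt
    have habs : ∀ n, |s * ((-1) ^ n * y n)| = |y n| := by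
      intro n
      rw [abs_mul, abs_mul, abs_pow, abs_neg, abs_one, one_pow]
      rcases hs with rfl | rfl <;> simp
    by_cases hall : ∀ n ≥ N, 0 ≤ s * ((-1) ^ n * y n)
    · rcases (hb.shift N).trichotomy_of_nonneg (fun n => hall _ (by omega)) with h' | h' | ⟨n, h'⟩
      · right; right; left
        have := tendsto_of_shift (y := fun n => s * ((-1) ^ n * y n)) N h'
        rw [tendsto_zero_iff_abs_tendsto_zero] at this ⊢
        simpa only [Function.comp_def, habs] using this
      · exact Or.inr (Or.inr (Or.inr (Or.inl ⟨s, hs,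
          tendsto_of_shift (y := fun n => s * ((-1) ^ n * y n)) N h'⟩)))
      · right; right; right; right
        refine ⟨n + N, ?_⟩
        rw [← habs, ← habs (n + N), abs_of_nonneg (hall _ (by omega)),
          abs_of_nonneg (hall _ (by omega))]
        simpa only [show n + 1 + N = n + N + 1 by omega] using h'
    · push Not at hall
      classical
      have hex : ∃ n, N ≤ n ∧ s * ((-1) ^ n * y n) < 0 := hall
      obtain ⟨hge, hneg⟩ := Nat.find_spec hex
      have hmin : ∀ m, N ≤ m → m < Nat.find hex → 0 ≤ s * ((-1) ^ m * y m) := fun m h1 h2 => by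
        have := Nat.find_min hex h2
        push Not at this
        exact this h1
      set K := Nat.find hex
      have hK : N + 2 ≤ K := by
        have h1 : K ≠ N := fun e => by rw [e] at hneg; linarith
        have h2 : K ≠ N + 1 := fun e => by rw [e] at hneg; linarith
        omega
      obtain ⟨m, hm⟩ : ∃ m, K = m + 2 := ⟨K - 2, by omega⟩
      rw [hm] at hneg
      have hlim := h.tendsto_of_alt_entry hs (hmin m (by omega) (by omega))
        (hmin (m + 1) (by omega) (by omega)) hneg
      rcases hs with rfl | rfl <;> rcases neg_one_pow_eq_or ℝ (m + 1) with e | e <;>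
        rw [e] at hlim <;> norm_num at hlim
      · exact Or.inl (by simpa using hlim)
      · exact Or.inr (Or.inl (by convert hlim using 2; norm_num))
      · exact Or.inr (Or.inl (by convert hlim using 2; norm_num))
      · exact Or.inl (by simpa using hlim)
  · push Not at hprod
    rcases lt_or_ge 0 (y 0) with hy | hy
    · have hpos : ∀ n, 0 < y n := by
        intro n
        induction n with
        | zero => exact hy
        | succ n ih => exact (pos_iff_pos_of_mul_pos (hprod n)).1 ih
      rcases h.tendsto_of_nonneg fun n => (hpos n).le with h' | h'
      · exact Or.inl h'
      · exact Or.inr (Or.inr (Or.inl h'))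
    · have hneg : ∀ n, y n ≤ 0 := by
        intro n
        induction n with
        | zero => exact hy
        | succ n ih =>
          have := hprod n
          by_contra hcon
          push Not at hcon
          nlinarith
      rcases h.neg.tendsto_of_nonneg fun n => by linarith [hneg n] with h' | h'
      · refine Or.inr (Or.inl ?_)
        have := h'.neg
        simp only [neg_neg] at this
        convert this using 2
        norm_num
      · refine Or.inr (Or.inr (Or.inl ?_))
        have := h'.neg
        simpa using this

/-! ### Orbits of `f` and their first coordinates -/

/-- The first coordinates of the orbit of `q`. -/
def coord (𝕜 : Type*) [Field 𝕜] (q : 𝕜 × 𝕜) (n : ℕ) : 𝕜 := ((f 𝕜)^[n] q).1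

section Field

variable {𝕜 : Type*} [Field 𝕜]

theorem coord_zero (q : 𝕜 × 𝕜) : coord 𝕜 q 0 = q.1 := rfl

theorem coord_one (q : 𝕜 × 𝕜) : coord 𝕜 q 1 = q.2 := rfl

theorem iterate_eq (q : 𝕜 × 𝕜) (n : ℕ) : (f 𝕜)^[n] q = (coord 𝕜 q n, coord 𝕜 q (n + 1)) := by
  refine Prod.ext rfl ?_
  rw [show coord 𝕜 q (n + 1) = ((f 𝕜)^[n + 1] q).1 from rfl, Function.iterate_succ_apply']
  rfl

theorem isOrbit_coord (q : 𝕜 × 𝕜) : IsOrbit (coord 𝕜 q) := by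
  intro n
  have : coord 𝕜 q (n + 2) = (f 𝕜 ((f 𝕜)^[n] q)).2 := by
    rw [coord, Function.iterate_succ_apply', Function.iterate_succ_apply']
    rfl
  rw [this, iterate_eq]
  rfl

theorem coord_iterate (q : 𝕜 × 𝕜) (N n : ℕ) : coord 𝕜 ((f 𝕜)^[N] q) n = coord 𝕜 q (n + N) := by
  rw [coord, coord, Function.iterate_add_apply]

theorem f_neg (q : 𝕜 × 𝕜) : f 𝕜 (-q) = -f 𝕜 q := by
  refine Prod.ext rfl ?_
  simp only [f, Prod.fst_neg, Prod.snd_neg]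
  ring

theorem coord_neg (q : 𝕜 × 𝕜) (n : ℕ) : coord 𝕜 (-q) n = -coord 𝕜 q n := by
  have : (f 𝕜)^[n] (-q) = -(f 𝕜)^[n] q := by
    induction n with
    | zero => rfl
    | succ n ih => rw [Function.iterate_succ_apply', Function.iterate_succ_apply', ih, f_neg]
  rw [coord, this]
  rfl

end Field

theorem coord_toComplex (q : ℝ × ℝ) (n : ℕ) : coord ℂ (toComplex q) n = (coord ℝ q n : ℂ) := by
  have : (f ℂ)^[n] (toComplex q) = toComplex ((f ℝ)^[n] q) := by
    induction n with
    | zero => rfl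
    | succ n ih =>
      rw [Function.iterate_succ_apply', Function.iterate_succ_apply', ih]
      refine Prod.ext rfl ?_
      simp only [f, toComplex]
      push_cast
      rfl
  rw [coord, this]
  rfl

section Normed

variable {𝕜 : Type*} [NormedField 𝕜]

theorem continuous_f : Continuous (f 𝕜) := by
  unfold f
  fun_prop

theorem continuous_coord (n : ℕ) : Continuous fun q : 𝕜 × 𝕜 => coord 𝕜 q n :=
  continuous_fst.comp (continuous_f.iterate n)

theorem tendsto_iterate_iff (q : 𝕜 × 𝕜) (a : 𝕜) :
    Tendsto (fun n => (f 𝕜)^[n] q) atTop (𝓝 (a, a)) ↔ Tendsto (coord 𝕜 q) atTop (𝓝 a) := by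
  simp only [iterate_eq]
  constructor
  · intro h
    exact (continuous_fst.tendsto _).comp h
  · intro h
    exact h.prodMk_nhds ((tendsto_add_atTop_iff_nat 1).2 h)

/-- The map `f` as a homeomorphism of the plane. -/
def homeo (𝕜 : Type*) [NormedField 𝕜] [CharZero 𝕜] : (𝕜 × 𝕜) ≃ₜ (𝕜 × 𝕜) where
  toFun := f 𝕜
  invFun q := (2 * (q.2 + q.1 ^ 3 - 3 / 4 * q.1), q.1)
  left_inv q := by
    refine Prod.ext ?_ rfl
    simp only [f]
    ring
  right_inv q := by
    refine Prod.ext rfl ?_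
    simp only [f]
    ring
  continuous_toFun := continuous_f
  continuous_invFun := by fun_prop

theorem iterate_mem_iff {S : Set (𝕜 × 𝕜)} (hS : ∀ q, f 𝕜 q ∈ S ↔ q ∈ S) (N : ℕ) (q : 𝕜 × 𝕜) :
    (f 𝕜)^[N] q ∈ S ↔ q ∈ S := by
  induction N with
  | zero => rfl
  | succ N ih => rw [Function.iterate_succ_apply', hS, ih]

/-- Accumulation may therefore be tested at a late iterate, whose whole orbit is already close to
the saddle. -/
theorem iterate_mem_closure_iff [CharZero 𝕜] {S : Set (𝕜 × 𝕜)} (hS : ∀ q, f 𝕜 q ∈ S ↔ q ∈ S)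
    (N : ℕ) (q : 𝕜 × 𝕜) : (f 𝕜)^[N] q ∈ closure S ↔ q ∈ closure S := by
  refine iterate_mem_iff (fun q => ?_) N q
  have h := (homeo 𝕜).preimage_closure S
  have e : (homeo 𝕜) ⁻¹' S = S := Set.ext hS
  rw [e] at h
  exact Set.ext_iff.1 h q

theorem iterate_mem_interior_iff [CharZero 𝕜] {S : Set (𝕜 × 𝕜)} (hS : ∀ q, f 𝕜 q ∈ S ↔ q ∈ S)
    (N : ℕ) (q : 𝕜 × 𝕜) : (f 𝕜)^[N] q ∈ interior S ↔ q ∈ interior S := by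
  refine iterate_mem_iff (fun q => ?_) N q
  have h := (homeo 𝕜).preimage_interior S
  have e : (homeo 𝕜) ⁻¹' S = S := Set.ext hS
  rw [e] at h
  exact Set.ext_iff.1 h q

end Normed

theorem continuous_toComplex : Continuous toComplex := by
  unfold toComplex
  fun_prop

/-! ### Basins, stable sets and the filled Julia set in terms of coordinates -/

theorem tendsto_coord_toComplex_iff (q : ℝ × ℝ) (a : ℝ) :
    Tendsto (coord ℂ (toComplex q)) atTop (𝓝 (a : ℂ)) ↔ Tendsto (coord ℝ q) atTop (𝓝 a) := by
  have e : coord ℂ (toComplex q) = fun n => (coord ℝ q n : ℂ) := funext (coord_toComplex q)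
  rw [e]
  constructor
  · intro h
    have := (Complex.continuous_re.tendsto _).comp h
    simpa [Function.comp_def] using this
  · intro h
    exact (Complex.continuous_ofReal.tendsto _).comp h

theorem mem_basinPlus_iff (q : ℝ × ℝ) :
    q ∈ basinPlus ↔ Tendsto (coord ℝ q) atTop (𝓝 (1 / 2)) := by
  rw [← tendsto_coord_toComplex_iff, ← tendsto_iterate_iff]
  rfl

theorem mem_basinMinus_iff (q : ℝ × ℝ) :
    q ∈ basinMinus ↔ Tendsto (coord ℝ q) atTop (𝓝 (-1 / 2)) := by
  rw [← tendsto_coord_toComplex_iff, ← tendsto_iterate_iff]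
  rfl

theorem neg_mem_basinMinus_iff (q : ℝ × ℝ) : -q ∈ basinMinus ↔ q ∈ basinPlus := by
  rw [mem_basinMinus_iff, mem_basinPlus_iff]
  have e : coord ℝ (-q) = fun n => -coord ℝ q n := funext (coord_neg q)
  rw [e, neg_div]
  constructor
  · intro h
    simpa using h.neg
  · intro h
    exact h.neg

theorem tendsto_coord_f_iff {𝕜 : Type*} [Field 𝕜] (q : 𝕜 × 𝕜) (l : Filter 𝕜) :
    Tendsto (coord 𝕜 (f 𝕜 q)) atTop l ↔ Tendsto (coord 𝕜 q) atTop l := by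
  have e : coord 𝕜 (f 𝕜 q) = fun n => coord 𝕜 q (n + 1) := funext (coord_iterate q 1)
  rw [e]
  exact tendsto_add_atTop_iff_nat 1

theorem f_mem_basinPlus_iff (q : ℝ × ℝ) : f ℝ q ∈ basinPlus ↔ q ∈ basinPlus := by
  rw [mem_basinPlus_iff, mem_basinPlus_iff, tendsto_coord_f_iff]

theorem f_mem_basinMinus_iff (q : ℝ × ℝ) : f ℝ q ∈ basinMinus ↔ q ∈ basinMinus := by
  rw [mem_basinMinus_iff, mem_basinMinus_iff, tendsto_coord_f_iff]

theorem mem_stableSet_zero_iff (q : ℝ × ℝ) :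
    q ∈ stableSet {(0, 0)} ↔ Tendsto (coord ℝ q) atTop (𝓝 0) := by
  rw [← tendsto_iterate_iff, tendsto_iff_dist_tendsto_zero, stableSet]
  simp only [Metric.infDist_singleton, Set.mem_ofPred_eq]

/-- By `IsOrbit.tendsto_half`, convergence is certified by an open condition at a single time. -/
theorem isOpen_complexBasin_half : IsOpen (complexBasin (1 / 2, 1 / 2)) := by
  have e : complexBasin (1 / 2, 1 / 2) =
      ⋃ n, {z | ‖coord ℂ z n - 1 / 2‖ < 1 / 5 ∧ ‖coord ℂ z (n + 1) - 1 / 2‖ < 1 / 5} := by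
    ext z
    simp only [complexBasin, Set.mem_ofPred_eq, Set.mem_iUnion, tendsto_iterate_iff]
    constructor
    · intro h
      have h2 := (tendsto_iff_norm_sub_tendsto_zero.1 h).eventually
        (gt_mem_nhds (by norm_num : (0 : ℝ) < 1 / 5))
      obtain ⟨N, hN⟩ := eventually_atTop.1 h2
      exact ⟨N, hN N le_rfl, hN (N + 1) (by omega)⟩
    · rintro ⟨N, h0, h1⟩
      refine tendsto_of_shift N (((isOrbit_coord z).shift N).tendsto_half ?_ ?_)
      · simpa using h0.le
      · simpa [add_comm] using h1.le
  rw [e]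
  refine isOpen_iUnion fun n => ?_
  exact (isOpen_lt (((continuous_coord n).sub continuous_const).norm) continuous_const).inter
    (isOpen_lt (((continuous_coord (n + 1)).sub continuous_const).norm) continuous_const)

theorem isOpen_complexBasin_pPlus : IsOpen (complexBasin (toComplex pPlus)) := by
  have : toComplex pPlus = (1 / 2, 1 / 2) := by simp [toComplex, pPlus]
  rw [this]
  exact isOpen_complexBasin_half

theorem isOpen_complexBasin_pMinus : IsOpen (complexBasin (toComplex pMinus)) := by
  have e : complexBasin (toComplex pMinus) = Neg.neg ⁻¹' complexBasin (1 / 2, 1 / 2) := by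
    ext z
    have : toComplex pMinus = (-(1 / 2), -(1 / 2)) := by simp [toComplex, pMinus, neg_div]
    rw [Set.mem_preimage, this]
    simp only [complexBasin, Set.mem_ofPred_eq, tendsto_iterate_iff]
    have e : coord ℂ (-z) = fun n => -coord ℂ z n := funext (coord_neg z)
    rw [e]
    constructor
    · intro h
      simpa using h.neg
    · intro h
      simpa using h.neg
  rw [e]
  exact isOpen_complexBasin_half.preimage continuous_neg

theorem isOpen_basinPlus : IsOpen basinPlus :=
  isOpen_complexBasin_pPlus.preimage continuous_toComplex

theorem isOpen_basinMinus : IsOpen basinMinus :=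
  isOpen_complexBasin_pMinus.preimage continuous_toComplex

theorem complexBasin_subset_KPlus (a : ℂ × ℂ) : complexBasin a ⊆ KPlus := fun _ hz =>
  Metric.isBounded_range_of_tendsto _ hz

theorem mem_KPlus_iff (z : ℂ × ℂ) : z ∈ KPlus ↔ ∃ C, ∀ n, ‖coord ℂ z n‖ ≤ C := by
  rw [KPlus, Set.mem_ofPred_eq, isBounded_iff_forall_norm_le]
  constructor
  · rintro ⟨C, hC⟩
    exact ⟨C, fun n => (norm_fst_le _).trans (hC _ ⟨n, rfl⟩)⟩
  · rintro ⟨C, hC⟩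
    refine ⟨C, ?_⟩
    rintro _ ⟨n, rfl⟩
    simp only [iterate_eq]
    exact max_le (hC n) (hC (n + 1))

theorem f_mem_KPlus_iff (z : ℂ × ℂ) : f ℂ z ∈ KPlus ↔ z ∈ KPlus := by
  have e : ∀ n, coord ℂ (f ℂ z) n = coord ℂ z (n + 1) := coord_iterate z 1
  simp only [mem_KPlus_iff, e]
  constructor
  · rintro ⟨C, hC⟩
    refine ⟨max C ‖coord ℂ z 0‖, fun n => ?_⟩
    rcases n with _ | n
    · exact le_max_right _ _
    · exact (hC n).trans (le_max_left _ _)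
  · rintro ⟨C, hC⟩
    exact ⟨C, fun n => hC _⟩

/-! ### Escape to infinity and membership in K⁺ -/

theorem IsOrbit.norm_growth {y : ℕ → ℂ} (h : IsOrbit y) {n : ℕ} (h0 : 2 < ‖y (n + 1)‖)
    (h1 : ‖y n‖ ≤ ‖y (n + 1)‖) : 2 * ‖y (n + 1)‖ ≤ ‖y (n + 2)‖ := by
  have e : y (n + 1) * y (n + 1) ^ 2 = y n / 2 + 3 / 4 * y (n + 1) - y (n + 2) := by
    rw [h n]; ring
  have h2 : ‖y (n + 1)‖ * ‖y (n + 1)‖ ^ 2 ≤ ‖y n‖ / 2 + 3 / 4 * ‖y (n + 1)‖ + ‖y (n + 2)‖ := by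
    rw [← norm_pow, ← norm_mul, e]
    refine (norm_sub_le _ _).trans (add_le_add_left ((norm_add_le _ _).trans ?_) _)
    rw [norm_div, norm_mul]
    norm_num
  -- With R = ‖y (n+1)‖ > 2 the next norm is at least R^3 - 5/4 R, hence above 2R.
  nlinarith [mul_pos (by linarith : 0 < ‖y (n + 1)‖) (by nlinarith : 0 < ‖y (n + 1)‖ ^ 2 - 4)]

theorem IsOrbit.norm_ge_pow {y : ℕ → ℂ} (h : IsOrbit y) {n : ℕ} (h0 : 2 < ‖y (n + 1)‖)
    (h1 : ‖y n‖ ≤ ‖y (n + 1)‖) (k : ℕ) : (2 : ℝ) ^ k ≤ ‖y (n + 1 + k)‖ := by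
  have key : ∀ k, 2 < ‖y (n + 1 + k)‖ ∧ ‖y (n + k)‖ ≤ ‖y (n + 1 + k)‖ ∧
      (2 : ℝ) ^ k ≤ ‖y (n + 1 + k)‖ := by
    intro k
    induction k with
    | zero => exact ⟨h0, h1, by simpa using by linarith⟩
    | succ k ih =>
      obtain ⟨a, b, c⟩ := ih
      rw [show n + 1 + k = n + k + 1 by omega] at a b c
      have g := h.norm_growth a b
      rw [show n + 1 + (k + 1) = n + k + 2 by omega, show n + (k + 1) = n + k + 1 by omega, pow_succ]
      exact ⟨by linarith, by linarith, by linarith⟩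
  exact (key k).2.2

/-- The points of `ℂ²` whose orbits enter the escape region. -/
def escapingSet : Set (ℂ × ℂ) :=
  {z | ∃ n, 2 < ‖coord ℂ z (n + 1)‖ ∧ ‖coord ℂ z n‖ < ‖coord ℂ z (n + 1)‖}

theorem isOpen_escapingSet : IsOpen escapingSet := by
  have e : escapingSet =
      ⋃ n, {z | 2 < ‖coord ℂ z (n + 1)‖ ∧ ‖coord ℂ z n‖ < ‖coord ℂ z (n + 1)‖} := by
    ext z
    simp [escapingSet]
  rw [e]
  refine isOpen_iUnion fun n => ?_
  exact (isOpen_lt continuous_const (continuous_coord (n + 1)).norm).inter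
    (isOpen_lt (continuous_coord n).norm (continuous_coord (n + 1)).norm)

/-- The strict inequality in `escapingSet` makes it open, while the classification supplies a weak
one; one doubling step closes the gap. -/
theorem mem_escapingSet_of_le {z : ℂ × ℂ} {n : ℕ} (h0 : 2 < ‖coord ℂ z (n + 1)‖)
    (h1 : ‖coord ℂ z n‖ ≤ ‖coord ℂ z (n + 1)‖) : z ∈ escapingSet := by
  have := (isOrbit_coord z).norm_growth h0 h1
  exact ⟨n + 1, by show 2 < ‖coord ℂ z (n + 2)‖; linarith,
    by show _ < ‖coord ℂ z (n + 2)‖; linarith⟩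

theorem escapingSet_subset : escapingSet ⊆ KPlusᶜ := by
  rintro z ⟨n, h0, h1⟩ hz
  obtain ⟨C, hC⟩ := (mem_KPlus_iff z).1 hz
  obtain ⟨k, hk⟩ := pow_unbounded_of_one_lt C (one_lt_two : (1 : ℝ) < 2)
  linarith [(isOrbit_coord z).norm_ge_pow h0 h1.le k, hC (n + 1 + k)]

theorem mem_KPlus_of_tendsto_infDist {q : ℝ × ℝ} {A : Set (ℝ × ℝ)} (hA : A.Finite)
    (hne : A.Nonempty) (hq : q ∈ stableSet A) : toComplex q ∈ KPlus := by
  obtain ⟨C, hC⟩ := isBounded_iff_forall_norm_le.1 hA.isBounded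
  obtain ⟨D, hD⟩ := isBounded_iff_forall_norm_le.1 (Metric.isBounded_range_of_tendsto _ hq)
  rw [mem_KPlus_iff]
  refine ⟨D + 1 + C, fun n => ?_⟩
  have h1 : Metric.infDist ((f ℝ)^[n] q) A < D + 1 := by
    have := hD _ ⟨n, rfl⟩
    rw [Real.norm_eq_abs] at this
    linarith [le_abs_self (Metric.infDist ((f ℝ)^[n] q) A)]
  obtain ⟨y, hy, hdist⟩ := (Metric.infDist_lt_iff hne).1 h1
  rw [coord_toComplex, Complex.norm_real]
  have h2 : ‖(f ℝ)^[n] q‖ ≤ ‖(f ℝ)^[n] q - y‖ + ‖y‖ := by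
    simpa using norm_add_le ((f ℝ)^[n] q - y) y
  rw [← dist_eq_norm] at h2
  linarith [hC y hy,
    show ‖coord ℝ q n‖ ≤ ‖(f ℝ)^[n] q‖ from norm_fst_le _]

theorem not_tendsto_of_mem_stableSet {q : ℝ × ℝ} {A : Set (ℝ × ℝ)} (hA : A.Finite)
    (hne : A.Nonempty) (hq : q ∈ stableSet A) {a : ℝ} (ha : (a, a) ∉ A) :
    ¬ Tendsto (coord ℝ q) atTop (𝓝 a) := by
  intro h
  rw [← tendsto_iterate_iff] at h
  have h1 := ((Metric.continuous_infDist_pt A).tendsto _).comp h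
  have h2 := tendsto_nhds_unique h1 hq
  exact ha ((hA.isClosed.mem_iff_infDist_zero hne).2 h2)

/-- The forward implication goes by elimination: the other four behaviours in
`IsOrbit.classification` are incompatible with approaching the cycle, so no tracking of the nearer
cycle point is needed. -/
theorem mem_stableSet_cycle_iff (q : ℝ × ℝ) :
    q ∈ stableSet {p, p'} ↔ ∃ s : ℝ, (s = 1 ∨ s = -1) ∧
      Tendsto (fun n => s * ((-1) ^ n * coord ℝ q n)) atTop (𝓝 (√5 / 2)) := by
  have hc := sqrt_five_div_two_pos
  constructor
  · intro hq
    have hfin : ({p, p'} : Set (ℝ × ℝ)).Finite := Set.toFinite _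
    have hne : ({p, p'} : Set (ℝ × ℝ)).Nonempty := ⟨p, by simp⟩
    have hnot : ∀ a : ℝ, (a, a) ∉ ({p, p'} : Set (ℝ × ℝ)) := by
      intro a ha
      simp only [Set.mem_insert_iff, Set.mem_singleton_iff, p, p', Prod.mk.injEq] at ha
      rcases ha with ⟨h1, h2⟩ | ⟨h1, h2⟩ <;> linarith
    rcases (isOrbit_coord q).classification with h | h | h | h | ⟨n, h0, h1⟩
    · exact absurd h (not_tendsto_of_mem_stableSet hfin hne hq (hnot _))
    · exact absurd h (not_tendsto_of_mem_stableSet hfin hne hq (hnot _))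
    · exact absurd h (not_tendsto_of_mem_stableSet hfin hne hq (hnot _))
    · exact h
    · refine absurd (mem_KPlus_of_tendsto_infDist hfin hne hq)
        (escapingSet_subset (mem_escapingSet_of_le (n := n) ?_ ?_)) <;>
        simpa only [coord_toComplex, Complex.norm_real, Real.norm_eq_abs]
  · rintro ⟨s, hs, h⟩
    have hbase : Tendsto (fun n => |s * ((-1) ^ n * coord ℝ q n) - √5 / 2|) atTop (𝓝 0) :=
      tendsto_iff_norm_sub_tendsto_zero.1 h
    have hmax := hbase.max ((tendsto_add_atTop_iff_nat 1).2 hbase)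
    rw [max_self] at hmax
    refine squeeze_zero (fun n => Metric.infDist_nonneg) (fun n => ?_) hmax
    obtain ⟨t, ht, hst⟩ : ∃ t : ℝ, (t = 1 ∨ t = -1) ∧ s * (-1) ^ n = t := by
      refine ⟨_, ?_, rfl⟩
      rcases hs with rfl | rfl <;> rcases neg_one_pow_eq_or ℝ n with e | e <;> simp [e]
    have e0 : s * ((-1) ^ n * coord ℝ q n) = t * coord ℝ q n := by rw [← hst]; ring
    have e1 : s * ((-1) ^ (n + 1) * coord ℝ q (n + 1)) = -(t * coord ℝ q (n + 1)) := by
      rw [← hst]; ring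
    rw [e0, e1]
    rcases ht with rfl | rfl
    · refine (Metric.infDist_le_dist_of_mem (y := p') (by simp)).trans (le_of_eq ?_)
      rw [iterate_eq, p', Prod.dist_eq, Real.dist_eq, Real.dist_eq]
      congr 1
      · simp
      · rw [← abs_neg]
        congr 1
        ring
    · refine (Metric.infDist_le_dist_of_mem (y := p) (by simp)).trans (le_of_eq ?_)
      rw [iterate_eq, p, Prod.dist_eq, Real.dist_eq, Real.dist_eq]
      congr 1
      · rw [← abs_neg]
        congr 1
        ring
      · simp

/-- Every real point lies in one of the basins, in one of the stable sets, or escapes. -/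
theorem real_classification (q : ℝ × ℝ) :
    q ∈ basinPlus ∨ q ∈ basinMinus ∨ q ∈ stableSet {(0, 0)} ∪ stableSet {p, p'} ∨
      toComplex q ∈ escapingSet := by
  rw [Set.mem_union, mem_stableSet_zero_iff, mem_stableSet_cycle_iff, mem_basinPlus_iff,
    mem_basinMinus_iff]
  rcases (isOrbit_coord q).classification with h | h | h | h | ⟨n, h0, h1⟩
  · exact Or.inl h
  · exact Or.inr (Or.inl h)
  · exact Or.inr (Or.inr (Or.inl (Or.inl h)))
  · exact Or.inr (Or.inr (Or.inl (Or.inr h)))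
  · refine Or.inr (Or.inr (Or.inr (mem_escapingSet_of_le (n := n) ?_ ?_))) <;>
      simpa only [coord_toComplex, Complex.norm_real, Real.norm_eq_abs]

theorem not_tendsto_half_of_mem {q : ℝ × ℝ} (hq : q ∈ stableSet {(0, 0)} ∪ stableSet {p, p'})
    {a : ℝ} (ha : a ≠ 0) : ¬ Tendsto (coord ℝ q) atTop (𝓝 a) := by
  have hc := sqrt_five_div_two_pos
  rcases hq with hq | hq
  · exact not_tendsto_of_mem_stableSet (Set.toFinite _) ⟨(0, 0), by simp⟩ hq (by simp [ha])
  · refine not_tendsto_of_mem_stableSet (Set.toFinite _) ⟨p, by simp⟩ hq ?_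
    intro ha
    simp only [Set.mem_insert_iff, Set.mem_singleton_iff, p, p', Prod.mk.injEq] at ha
    rcases ha with ⟨h1, h2⟩ | ⟨h1, h2⟩ <;> linarith

theorem mem_KPlus_of_mem_stableSets {q : ℝ × ℝ}
    (hq : q ∈ stableSet {(0, 0)} ∪ stableSet {p, p'}) : toComplex q ∈ KPlus := by
  rcases hq with hq | hq
  · exact mem_KPlus_of_tendsto_infDist (Set.toFinite _) ⟨(0, 0), by simp⟩ hq
  · exact mem_KPlus_of_tendsto_infDist (Set.toFinite _) ⟨p, by simp⟩ hq

/-! ### Frontiers of the basins and the real Julia set lie in the stable sets -/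

theorem disjoint_basins : Disjoint basinPlus basinMinus := by
  rw [Set.disjoint_left]
  intro q h1 h2
  rw [mem_basinPlus_iff] at h1
  rw [mem_basinMinus_iff] at h2
  have := tendsto_nhds_unique h1 h2
  norm_num at this

theorem toComplex_mem_KPlus_of_mem_basin {q : ℝ × ℝ} (hq : q ∈ basinPlus ∪ basinMinus) :
    toComplex q ∈ interior KPlus := by
  rcases hq with hq | hq
  · exact interior_maximal (complexBasin_subset_KPlus _) isOpen_complexBasin_pPlus hq
  · exact interior_maximal (complexBasin_subset_KPlus _) isOpen_complexBasin_pMinus hq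

theorem disjoint_basin_escaping : Disjoint (basinPlus ∪ basinMinus)
    (realSection escapingSet) := by
  rw [Set.disjoint_left]
  intro q h1 h2
  exact escapingSet_subset h2 (interior_subset (toComplex_mem_KPlus_of_mem_basin h1))

theorem isOpen_realSection_escapingSet : IsOpen (realSection escapingSet) :=
  isOpen_escapingSet.preimage continuous_toComplex

/-- The frontier of an open set misses that set and every open set disjoint from it, which excludes
all other classes of `real_classification`. -/
theorem frontier_basinPlus_subset :
    frontier basinPlus ⊆ stableSet {(0, 0)} ∪ stableSet {p, p'} := by
  intro q hq
  rw [isOpen_basinPlus.frontier_eq] at hq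
  rcases real_classification q with h | h | h | h
  · exact absurd h hq.2
  · exact absurd h ((disjoint_basins.closure_left isOpen_basinMinus).notMem_of_mem_left hq.1)
  · exact h
  · exact absurd h (((disjoint_basin_escaping.mono_left Set.subset_union_left).closure_left
      isOpen_realSection_escapingSet).notMem_of_mem_left hq.1)

theorem frontier_basinMinus_subset :
    frontier basinMinus ⊆ stableSet {(0, 0)} ∪ stableSet {p, p'} := by
  intro q hq
  rw [isOpen_basinMinus.frontier_eq] at hq
  rcases real_classification q with h | h | h | h
  · exact absurd h ((disjoint_basins.symm.closure_left isOpen_basinPlus).notMem_of_mem_left hq.1)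
  · exact absurd h hq.2
  · exact h
  · exact absurd h (((disjoint_basin_escaping.mono_left Set.subset_union_right).closure_left
      isOpen_realSection_escapingSet).notMem_of_mem_left hq.1)

theorem realJPlus_subset : realJPlus ⊆ stableSet {(0, 0)} ∪ stableSet {p, p'} := by
  intro q hq
  replace hq : toComplex q ∈ frontier KPlus := hq
  rcases real_classification q with h | h | h | h
  · exact absurd (toComplex_mem_KPlus_of_mem_basin (Or.inl h)) hq.2
  · exact absurd (toComplex_mem_KPlus_of_mem_basin (Or.inr h)) hq.2
  · exact h
  · have h1 : Disjoint KPlus escapingSet :=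
      disjoint_compl_right.mono_right escapingSet_subset
    exact absurd h ((h1.closure_left isOpen_escapingSet).notMem_of_mem_left hq.1)

/-! ### Accumulation of both basins at the stable set of the origin -/

/-- An orbit starting slightly above one that stays near the origin converges to `1 / 2`. -/
theorem IsOrbit.tendsto_half_of_lt {u v : ℕ → ℝ} (hu : IsOrbit u) (hv : IsOrbit v)
    (hsmall : ∀ n, |u n| ≤ 1 / 100) (h0 : u 0 < v 0) (h1 : u 1 < v 1) (hv0 : v 0 ≤ 1 / 4)
    (hv1 : v 1 ≤ 1 / 4) : Tendsto v atTop (𝓝 (1 / 2)) := by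
  have hlo : ∀ n, -(1 / 100) ≤ u n := fun n => (abs_le.1 (hsmall n)).1
  have hhi : ∀ n, u n ≤ 1 / 100 := fun n => (abs_le.1 (hsmall n)).2
  -- The cubic has difference quotient 3/4 - (b^2 + ab + a^2) ≥ 9/16 here, so the gap v - u expands
  -- by 1/2 + 9/16 = 17/16 per block.
  have step : ∀ n, u n < v n → u (n + 1) < v (n + 1) → v (n + 1) ≤ 1 / 4 →
      (v n - u n) / 2 + 9 / 16 * (v (n + 1) - u (n + 1)) ≤ v (n + 2) - u (n + 2) := by
    intro n hn hn1 hle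
    have l := hlo (n + 1)
    have r := hhi (n + 1)
    rw [hu n, hv n]
    set a := u (n + 1)
    set b := v (n + 1)
    have : 0 ≤ (b - a) * (3 / 16 - (b ^ 2 + a * b + a ^ 2)) := by
      refine mul_nonneg (by linarith) ?_
      nlinarith
    nlinarith
  by_cases hall : ∀ n, v n ≤ 1 / 4
  · exfalso
    have hlt : ∀ n, u n < v n ∧ u (n + 1) < v (n + 1) := by
      intro n
      induction n with
      | zero => exact ⟨h0, h1⟩
      | succ n ih =>
        refine ⟨ih.2, ?_⟩
        have := step n ih.1 ih.2 (hall _)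
        show u (n + 2) < v (n + 2)
        linarith [ih.1, ih.2]
    obtain ⟨N, hN⟩ := eventually_ge_of_min_le (s := fun n => v n - u n) (B := 1) (r := 17 / 16)
      (by norm_num) (by norm_num) (sub_pos.2 h0) (sub_pos.2 h1) fun n => by
        refine (min_le_right _ _).trans (le_trans ?_ (step n (hlt n).1 (hlt n).2 (hall _)))
        linarith [min_le_left (v n - u n) (v (n + 1) - u (n + 1)),
          min_le_right (v n - u n) (v (n + 1) - u (n + 1))]
    have := hN N le_rfl
    beta_reduce at this
    linarith [hall N, hlo N]
  -- At the first time v exceeds 1/4, it and its successor both lie in (0, 3/8], hence in the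
  -- absorbing quadrant region.
  · push Not at hall
    classical
    have hfind := Nat.find_spec hall
    have hmin : ∀ m < Nat.find hall, v m ≤ 1 / 4 := fun m hm => by
      simpa using Nat.find_min hall hm
    set K := Nat.find hall
    have hK : 2 ≤ K := by
      have e0 : K ≠ 0 := fun e => by rw [e] at hfind; linarith
      have e1 : K ≠ 1 := fun e => by rw [e] at hfind; linarith
      omega
    have hlt : ∀ n < K, u n < v n ∧ u (n + 1) < v (n + 1) := by
      intro n
      induction n with
      | zero => exact fun _ => ⟨h0, h1⟩
      | succ n ih =>
        intro hn
        have ih := ih (by omega)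
        refine ⟨ih.2, ?_⟩
        have := step n ih.1 ih.2 (hmin _ hn)
        show u (n + 2) < v (n + 2)
        linarith [ih.1, ih.2]
    obtain ⟨m, hm⟩ : ∃ m, K = m + 2 := ⟨K - 2, by omega⟩
    rw [hm] at hfind
    have b0 := hmin m (by omega)
    have b1 := hmin (m + 1) (by omega)
    have l1 := (hlt (m + 1) (by omega)).1
    have e2 := hv m
    have e3 := hv (m + 1)
    have l1' := hlo (m + 1)
    simp only [show m + 1 + 2 = m + 3 by omega, show m + 1 + 1 = m + 2 by omega] at e3
    set a := v m
    set b := v (m + 1)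
    set c := v (m + 2)
    have hc : c ≤ 3 / 8 := by
      nlinarith [mul_nonneg (sq_nonneg (b - 1 / 2)) (by linarith : 0 ≤ b + 1)]
    have hd0 : 0 < v (m + 3) := by
      nlinarith [mul_pos (by linarith : 0 < c) (by nlinarith : 0 < 1 / 2 - c ^ 2)]
    have hd1 : v (m + 3) ≤ 3 / 8 := by
      nlinarith [mul_nonneg (sq_nonneg (c - 1 / 2)) (by linarith : 0 ≤ c + 1)]
    refine tendsto_of_shift (m + 2) ((hv.shift (m + 2)).tendsto_half_of_quadrant ?_ ?_ ?_ ?_ ?_)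
    · simp only [Nat.zero_add]; linarith
    · simp only [show 1 + (m + 2) = m + 3 by omega]; linarith
    · simp only [Nat.zero_add]; nlinarith
    · simp only [show 1 + (m + 2) = m + 3 by omega]; nlinarith
    · simp only [Nat.zero_add]; left; linarith

theorem stableSet_zero_subset_closure_basinPlus : stableSet {(0, 0)} ⊆ closure basinPlus := by
  intro q hq
  rw [mem_stableSet_zero_iff] at hq
  have habs := (tendsto_zero_iff_abs_tendsto_zero _).1 hq
  obtain ⟨N, hN⟩ := eventually_atTop.1
    (habs.eventually (gt_mem_nhds (by norm_num : (0 : ℝ) < 1 / 100)))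
  rw [← iterate_mem_closure_iff f_mem_basinPlus_iff N]
  set w := (f ℝ)^[N] q
  have hw : ∀ n, |coord ℝ w n| ≤ 1 / 100 := fun n => by
    rw [coord_iterate]
    exact (hN (n + N) (by omega)).le
  rw [Metric.mem_closure_iff]
  intro ε hε
  have h0 := abs_le.1 (hw 0)
  have h1 := abs_le.1 (hw 1)
  rw [coord_zero] at h0
  rw [coord_one] at h1
  -- Since 1/100 + 1/10 ≤ 1/4, the displaced coordinates satisfy the starting bounds of
  -- `IsOrbit.tendsto_half_of_lt`.
  obtain ⟨η, hη0, hη1, hη2⟩ : ∃ η : ℝ, 0 < η ∧ η < ε ∧ η ≤ 1 / 10 :=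
    ⟨min (ε / 2) (1 / 10), by positivity, (min_le_left _ _).trans_lt (by linarith),
      min_le_right _ _⟩
  refine ⟨(w.1 + η, w.2 + η), ?_, ?_⟩
  · rw [mem_basinPlus_iff]
    refine (isOrbit_coord w).tendsto_half_of_lt (isOrbit_coord _) hw ?_ ?_ ?_ ?_
    · rw [coord_zero, coord_zero]; linarith
    · rw [coord_one, coord_one]; linarith
    · rw [coord_zero]; linarith [h0.2]
    · rw [coord_one]; linarith [h1.2]
  · rw [Prod.dist_eq, Real.dist_eq, Real.dist_eq]
    simp only [sub_add_cancel_left, abs_neg, abs_of_pos hη0, max_self]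
    exact hη1

theorem neg_mem_stableSet_zero {q : ℝ × ℝ} (hq : q ∈ stableSet {(0, 0)}) :
    -q ∈ stableSet {(0, 0)} := by
  rw [mem_stableSet_zero_iff] at hq ⊢
  have e : coord ℝ (-q) = fun n => -coord ℝ q n := funext (coord_neg q)
  rw [e]
  simpa using hq.neg

theorem neg_mem_closure_basinMinus_iff (q : ℝ × ℝ) :
    -q ∈ closure basinMinus ↔ q ∈ closure basinPlus := by
  have h := (Homeomorph.neg (ℝ × ℝ)).preimage_closure basinMinus
  have e : (Homeomorph.neg (ℝ × ℝ)) ⁻¹' basinMinus = basinPlus := Set.ext neg_mem_basinMinus_iff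
  rw [e] at h
  exact Set.ext_iff.1 h q

theorem stableSet_zero_subset_closure_basinMinus : stableSet {(0, 0)} ⊆ closure basinMinus := by
  intro q hq
  rw [← neg_neg q, neg_mem_closure_basinMinus_iff]
  exact stableSet_zero_subset_closure_basinPlus (neg_mem_stableSet_zero hq)

/-! ### Accumulation of both basins at the stable set of the cycle -/

/-- The critical points are ±1/2. This lemma and `cubic_anti` drive both the comparison of orbits
and the interval enclosures below. -/
theorem cubic_mono {x y : ℝ} (hx : 1 / 2 ≤ x) (hxy : x ≤ y) :
    x ^ 3 - 3 / 4 * x ≤ y ^ 3 - 3 / 4 * y := by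
  nlinarith [mul_nonneg (sub_nonneg.2 hxy) (by nlinarith : 0 ≤ y ^ 2 + x * y + x ^ 2 - 3 / 4)]

theorem cubic_anti {x y : ℝ} (hx : 0 ≤ x) (hxy : x ≤ y) (hy : y ≤ 1 / 2) :
    y ^ 3 - 3 / 4 * y ≤ x ^ 3 - 3 / 4 * x := by
  nlinarith [mul_nonneg (sub_nonneg.2 hxy) (by nlinarith : 0 ≤ 3 / 4 - (y ^ 2 + x * y + x ^ 2))]

/-- The alternating recurrence preserves order as long as the lower orbit stays where the cubic
increases. -/
theorem IsAltOrbit.le_of_le {u v : ℕ → ℝ} (hu : IsAltOrbit u) (hv : IsAltOrbit v) (h0 : u 0 ≤ v 0)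
    (h1 : u 1 ≤ v 1) {n : ℕ} (hn : ∀ j < n, 1 / 2 ≤ u j) : ∀ j ≤ n, u j ≤ v j := by
  have key : ∀ j, (j ≤ n → u j ≤ v j) ∧ (j + 1 ≤ n → u (j + 1) ≤ v (j + 1)) := by
    intro j
    induction j with
    | zero => exact ⟨fun _ => h0, fun _ => h1⟩
    | succ j ih =>
      refine ⟨ih.2, fun hj => ?_⟩
      have a := ih.1 (by omega)
      have b := ih.2 (by omega)
      show u (j + 2) ≤ v (j + 2)
      have := cubic_mono (hn (j + 1) (by omega)) b
      rw [hu j, hv j]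
      linarith
  exact fun j => (key j).1

/-- Above 9/10 the cubic has slope at least 1, so the gap between the orbits would grow by 3/2 per
block, against v ≤ 2. -/
theorem IsAltOrbit.exists_lt {u v : ℕ → ℝ} (hu : IsAltOrbit u) (hv : IsAltOrbit v)
    (h0 : u 0 < v 0) (h1 : u 1 < v 1) (hb : ∀ n, v n ≤ 2) : ∃ n, u n < 9 / 10 := by
  by_contra hcon
  push Not at hcon
  have step : ∀ n, u n < v n → u (n + 1) < v (n + 1) →
      (v n - u n) / 2 + (v (n + 1) - u (n + 1)) ≤ v (n + 2) - u (n + 2) := by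
    intro n hn hn1
    have l := hcon (n + 1)
    rw [hu n, hv n]
    set a := u (n + 1)
    set b := v (n + 1)
    have : 0 ≤ (b - a) * ((b ^ 2 + a * b + a ^ 2) - 7 / 4) := by
      refine mul_nonneg (by linarith) ?_
      nlinarith
    nlinarith
  have hlt : ∀ n, u n < v n ∧ u (n + 1) < v (n + 1) := by
    intro n
    induction n with
    | zero => exact ⟨h0, h1⟩
    | succ n ih =>
      refine ⟨ih.2, ?_⟩
      have := step n ih.1 ih.2
      show u (n + 2) < v (n + 2)
      linarith [ih.1, ih.2]
  obtain ⟨N, hN⟩ := eventually_ge_of_min_le (s := fun n => v n - u n) (B := 2) (r := 3 / 2)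
    (by norm_num) (by norm_num) (sub_pos.2 h0) (sub_pos.2 h1) fun n => by
      refine (min_le_right _ _).trans (le_trans ?_ (step n (hlt n).1 (hlt n).2))
      linarith [min_le_left (v n - u n) (v (n + 1) - u (n + 1)),
        min_le_right (v n - u n) (v (n + 1) - u (n + 1))]
  have := hN N le_rfl
  beta_reduce at this
  linarith [hb N, hcon N]

theorem sqrt_five_div_two_bounds : 1118 / 1000 < √5 / 2 ∧ √5 / 2 < 11181 / 10000 := by
  have h := sqrt_five_div_two_sq
  have h0 := sqrt_five_div_two_pos
  constructor <;> nlinarith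

/-- Bounds on the value preceding `b` on an alternating orbit that stays near the cycle. -/
theorem IsAltOrbit.pred_bounds {u : ℕ → ℝ} (h : IsAltOrbit u) {l m r : ℝ} (hu1 : 1 / 2 ≤ u 1)
    (hu2 : 1 / 2 ≤ u 2) (hU0 : u 0 ≤ 28 / 25) (hU1 : u 1 ≤ 28 / 25)
    (hr : 1 / 2 ≤ r) (h1 : l ^ 3 - 3 / 4 * l < u 3 - 14 / 25)
    (h2 : m ^ 3 - 3 / 4 * m < l - 14 / 25) (h3 : u 3 - m / 2 < r ^ 3 - 3 / 4 * r) :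
    l ≤ u 2 ∧ u 2 ≤ r := by
  have e0 : u 2 = u 0 / 2 + u 1 ^ 3 - 3 / 4 * u 1 := h 0
  have e1 : u 3 = u 1 / 2 + u 2 ^ 3 - 3 / 4 * u 2 := h 1
  -- The upper bound on u 1 gives l ≤ u 2; with the upper bound on u 0 this gives m ≤ u 1, which in
  -- turn yields u 2 ≤ r.
  have hlu : l ≤ u 2 := by
    by_contra hcon
    have := cubic_mono hu2 (not_le.1 hcon).le
    linarith
  have hmu : m ≤ u 1 := by
    by_contra hcon
    have := cubic_mono hu1 (not_le.1 hcon).le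
    linarith
  refine ⟨hlu, ?_⟩
  by_contra hcon
  have := cubic_mono hr (not_le.1 hcon).le
  linarith

/-- Fixing u 3 confines u 2 to a short interval, because the past stays near the cycle. Monotonicity
of the cubic on either side of 1/2 then propagates enclosures up to the break of sign. -/
theorem IsAltOrbit.signs_of_eq_23_div_25 {u : ℕ → ℝ} (h : IsAltOrbit u) (hu1 : 1 / 2 ≤ u 1)
    (hu2 : 1 / 2 ≤ u 2) (hU0 : u 0 ≤ 28 / 25) (hU1 : u 1 ≤ 28 / 25) (h3 : u 3 = 23 / 25) :
    0 ≤ u 7 ∧ 0 ≤ u 8 ∧ u 9 < 0 := by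
  obtain ⟨l2, r2⟩ := h.pred_bounds (l := 1046 / 1000) (m := 1092 / 1000) (r := 1052 / 1000)
    hu1 hu2 hU0 hU1 (by norm_num) (by rw [h3]; norm_num)
    (by norm_num) (by rw [h3]; norm_num)
  have e4 : u 4 = u 2 / 2 + u 3 ^ 3 - 3 / 4 * u 3 := h 2
  have e5 : u 5 = u 3 / 2 + u 4 ^ 3 - 3 / 4 * u 4 := h 3
  have e6 : u 6 = u 4 / 2 + u 5 ^ 3 - 3 / 4 * u 5 := h 4
  have e7 : u 7 = u 5 / 2 + u 6 ^ 3 - 3 / 4 * u 6 := h 5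
  have e8 : u 8 = u 6 / 2 + u 7 ^ 3 - 3 / 4 * u 7 := h 6
  have e9 : u 9 = u 7 / 2 + u 8 ^ 3 - 3 / 4 * u 8 := h 7
  rw [h3] at e4 e5
  have l4 : 611 / 1000 ≤ u 4 := by linarith
  have r4 : u 4 ≤ 615 / 1000 := by linarith
  have l5 : 229 / 1000 ≤ u 5 := by linarith [cubic_mono (by norm_num) l4]
  have r5 : u 5 ≤ 232 / 1000 := by linarith [cubic_mono (by linarith) r4]
  have l6 : 143 / 1000 ≤ u 6 := by linarith [cubic_anti (by linarith) r5 (by norm_num)]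
  have r6 : u 6 ≤ 148 / 1000 := by linarith [cubic_anti (by norm_num) l5 (by linarith)]
  have l7 : 6 / 1000 ≤ u 7 := by linarith [cubic_anti (by linarith) r6 (by norm_num)]
  have r7 : u 7 ≤ 12 / 1000 := by linarith [cubic_anti (by norm_num) l6 (by linarith)]
  have l8 : 62 / 1000 ≤ u 8 := by linarith [cubic_anti (by linarith) r7 (by norm_num)]
  have r8 : u 8 ≤ 70 / 1000 := by linarith [cubic_anti (by norm_num) l7 (by linarith)]
  have r9 : u 9 < 0 := by linarith [cubic_anti (by norm_num) l8 (by linarith)]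
  exact ⟨by linarith, by linarith, r9⟩

/-- Same enclosure argument, with the break one index later than for 23/25: the opposite parity,
hence the opposite basin. -/
theorem IsAltOrbit.signs_of_eq_101_div_100 {u : ℕ → ℝ} (h : IsAltOrbit u) (hu1 : 1 / 2 ≤ u 1)
    (hu2 : 1 / 2 ≤ u 2) (hU0 : u 0 ≤ 28 / 25) (hU1 : u 1 ≤ 28 / 25) (h3 : u 3 = 101 / 100) :
    0 ≤ u 8 ∧ 0 ≤ u 9 ∧ u 10 < 0 := by
  obtain ⟨l2, r2⟩ := h.pred_bounds (l := 1080 / 1000) (m := 1104 / 1000) (r := 1084 / 1000)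
    hu1 hu2 hU0 hU1 (by norm_num) (by rw [h3]; norm_num)
    (by norm_num) (by rw [h3]; norm_num)
  have e4 : u 4 = u 2 / 2 + u 3 ^ 3 - 3 / 4 * u 3 := h 2
  have e5 : u 5 = u 3 / 2 + u 4 ^ 3 - 3 / 4 * u 4 := h 3
  have e6 : u 6 = u 4 / 2 + u 5 ^ 3 - 3 / 4 * u 5 := h 4
  have e7 : u 7 = u 5 / 2 + u 6 ^ 3 - 3 / 4 * u 6 := h 5
  have e8 : u 8 = u 6 / 2 + u 7 ^ 3 - 3 / 4 * u 7 := h 6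
  have e9 : u 9 = u 7 / 2 + u 8 ^ 3 - 3 / 4 * u 8 := h 7
  have e10 : u 10 = u 8 / 2 + u 9 ^ 3 - 3 / 4 * u 9 := h 8
  rw [h3] at e4 e5
  have l4 : 812 / 1000 ≤ u 4 := by linarith
  have r4 : u 4 ≤ 815 / 1000 := by linarith
  have l5 : 431 / 1000 ≤ u 5 := by linarith [cubic_mono (by norm_num) l4]
  have r5 : u 5 ≤ 436 / 1000 := by linarith [cubic_mono (by linarith) r4]
  have l6 : 161 / 1000 ≤ u 6 := by linarith [cubic_anti (by linarith) r5 (by norm_num)]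
  have r6 : u 6 ≤ 165 / 1000 := by linarith [cubic_anti (by norm_num) l5 (by linarith)]
  have l7 : 96 / 1000 ≤ u 7 := by linarith [cubic_anti (by linarith) r6 (by norm_num)]
  have r7 : u 7 ≤ 102 / 1000 := by linarith [cubic_anti (by norm_num) l6 (by linarith)]
  have l8 : 5 / 1000 ≤ u 8 := by linarith [cubic_anti (by linarith) r7 (by norm_num)]
  have r8 : u 8 ≤ 12 / 1000 := by linarith [cubic_anti (by norm_num) l7 (by linarith)]
  have l9 : 39 / 1000 ≤ u 9 := by linarith [cubic_anti (by linarith) r8 (by norm_num)]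
  have r9 : u 9 ≤ 48 / 1000 := by linarith [cubic_anti (by norm_num) l8 (by linarith)]
  have r10 : u 10 < 0 := by linarith [cubic_anti (by norm_num) l9 (by linarith)]
  exact ⟨by linarith, by linarith, r10⟩

/-- The alternating orbit of a point, with overall sign `s`. -/
noncomputable def altCoord (s : ℝ) (q : ℝ × ℝ) (n : ℕ) : ℝ := s * ((-1) ^ n * coord ℝ q n)

theorem isAltOrbit_altCoord {s : ℝ} (hs : s = 1 ∨ s = -1) (q : ℝ × ℝ) :
    IsAltOrbit (altCoord s q) := by
  have e : altCoord s q = fun n => (-1) ^ n * (s * coord ℝ q n) := by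
    funext n
    simp only [altCoord]
    ring
  rw [e]
  exact ((isOrbit_coord q).sign_mul hs).alt

theorem continuous_altCoord (s : ℝ) (n : ℕ) : Continuous fun q => altCoord s q n :=
  continuous_const.mul (continuous_const.mul (continuous_coord n))

/-- Arbitrarily near a point whose orbit shadows the cycle there are points of both basins. -/
theorem exists_near_of_altCoord {s : ℝ} (hs : s = 1 ∨ s = -1) {w : ℝ × ℝ}
    (hw : ∀ n, |altCoord s w n - √5 / 2| ≤ 1 / 1000) {η : ℝ} (hη : 0 < η) (hη' : η ≤ 1 / 100) :
    ∃ t : ℝ, (t = 1 ∨ t = -1) ∧ (∃ z, dist w z ≤ η ∧ Tendsto (coord ℝ z) atTop (𝓝 (t / 2))) ∧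
      ∃ z, dist w z ≤ η ∧ Tendsto (coord ℝ z) atTop (𝓝 (-t / 2)) := by
  obtain ⟨hc1, hc2⟩ := sqrt_five_div_two_bounds
  have hlo : ∀ n, 1117 / 1000 ≤ altCoord s w n := fun n => by linarith [(abs_le.1 (hw n)).1]
  have hhi : ∀ n, altCoord s w n ≤ 28 / 25 := fun n => by linarith [(abs_le.1 (hw n)).2]
  have hss : s * s = 1 := by rcases hs with rfl | rfl <;> norm_num
  -- The signs are chosen so that the first two alternating coordinates both decrease by ε.
  set W : ℝ → ℝ × ℝ := fun ε => (w.1 - s * ε, w.2 + s * ε) with hWdef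
  have hWc : Continuous W := by fun_prop
  have hW0 : ∀ ε, altCoord s (W ε) 0 = altCoord s w 0 - ε := by
    intro ε
    simp only [altCoord, coord_zero, hWdef]
    linear_combination -ε * hss
  have hW1 : ∀ ε, altCoord s (W ε) 1 = altCoord s w 1 - ε := by
    intro ε
    simp only [altCoord, coord_one, hWdef]
    linear_combination -ε * hss
  have hWd : ∀ ε, 0 ≤ ε → dist w (W ε) = ε := by
    intro ε hε
    rw [Prod.dist_eq, Real.dist_eq, Real.dist_eq]
    simp only [hWdef, sub_sub_cancel, sub_add_cancel_left, abs_neg, max_self]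
    rcases hs with rfl | rfl <;> simp [abs_of_nonneg hε]
  have hWw : W 0 = w := by simp [hWdef]
  have hex := (isAltOrbit_altCoord hs (W η)).exists_lt (isAltOrbit_altCoord hs w)
    (by rw [hW0]; linarith) (by rw [hW1]; linarith) (fun n => by linarith [hhi n])
  classical
  have hfind := Nat.find_spec hex
  have hmin : ∀ m < Nat.find hex, 9 / 10 ≤ altCoord s (W η) m := fun m hm => by
    simpa using Nat.find_min hex hm
  set K := Nat.find hex
  have g0 : 11 / 10 ≤ altCoord s (W η) 0 := by rw [hW0]; linarith [hlo 0]
  have g1 : 11 / 10 ≤ altCoord s (W η) 1 := by rw [hW1]; linarith [hlo 1]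
  have g2 : 105 / 100 ≤ altCoord s (W η) 2 := by
    have e := isAltOrbit_altCoord hs (W η) 0
    simp only [Nat.zero_add] at e
    linarith [cubic_mono (by norm_num) g1]
  have hK : 3 ≤ K := by
    have e0 : K ≠ 0 := fun e => by rw [e] at hfind; linarith
    have e1 : K ≠ 1 := fun e => by rw [e] at hfind; linarith
    have e2 : K ≠ 2 := fun e => by rw [e] at hfind; linarith
    omega
  obtain ⟨k, hk⟩ : ∃ k, K = k + 3 := ⟨K - 3, by omega⟩
  -- At time K the value runs from above 11/10 at ε = 0 to below 9/10 at ε = η, so it takes the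
  -- value β. Comparison with the orbits of W η and w confines the earlier terms.
  have key : ∀ β, 9 / 10 ≤ β → β ≤ 11 / 10 → ∃ ε, 0 ≤ ε ∧ ε ≤ η ∧ altCoord s (W ε) K = β ∧
      ∀ j < K, 1 / 2 ≤ altCoord s (W ε) j ∧ altCoord s (W ε) j ≤ 28 / 25 := by
    intro β hβ hβ'
    have hcont : ContinuousOn (fun ε => altCoord s (W ε) K) (Set.Icc 0 η) :=
      ((continuous_altCoord s K).comp hWc).continuousOn
    obtain ⟨ε, hε, hεβ⟩ := intermediate_value_Icc' hη.le hcont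
      (show β ∈ Set.Icc (altCoord s (W η) K) (altCoord s (W 0) K) from
        ⟨by linarith, by rw [hWw]; linarith [hlo K]⟩)
    have hge : ∀ j ≤ K, altCoord s (W η) j ≤ altCoord s (W ε) j :=
      (isAltOrbit_altCoord hs (W η)).le_of_le (isAltOrbit_altCoord hs (W ε))
        (by rw [hW0, hW0]; linarith [hε.2]) (by rw [hW1, hW1]; linarith [hε.2])
        fun j hj => by linarith [hmin j hj]
    have hlow : ∀ j < K, 1 / 2 ≤ altCoord s (W ε) j := fun j hj => by
      linarith [hmin j hj, hge j hj.le]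
    have hle : ∀ j ≤ K, altCoord s (W ε) j ≤ altCoord s w j :=
      (isAltOrbit_altCoord hs (W ε)).le_of_le (isAltOrbit_altCoord hs w)
        (by rw [hW0]; linarith [hε.1]) (by rw [hW1]; linarith [hε.1]) hlow
    exact ⟨ε, hε.1, hε.2, hεβ, fun j hj => ⟨hlow j hj, (hle j hj.le).trans (hhi j)⟩⟩
  obtain ⟨ε₁, a0, a1, a2, a3⟩ := key (23 / 25) (by norm_num) (by norm_num)
  obtain ⟨ε₂, b0, b1, b2, b3⟩ := key (101 / 100) (by norm_num) (by norm_num)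
  have sg : ∀ {ε}, (∀ j < K, 1 / 2 ≤ altCoord s (W ε) j ∧ altCoord s (W ε) j ≤ 28 / 25) →
      1 / 2 ≤ altCoord s (W ε) (1 + k) ∧ 1 / 2 ≤ altCoord s (W ε) (2 + k) ∧
      altCoord s (W ε) (0 + k) ≤ 28 / 25 ∧ altCoord s (W ε) (1 + k) ≤ 28 / 25 := fun h =>
    ⟨(h _ (by omega)).1, (h _ (by omega)).1, (h _ (by omega)).2, (h _ (by omega)).2⟩
  have s1 := ((isAltOrbit_altCoord hs (W ε₁)).shift k).signs_of_eq_23_div_25 (sg a3).1 (sg a3).2.1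
    (sg a3).2.2.1 (sg a3).2.2.2 (by rw [show 3 + k = K by omega]; exact a2)
  have s2 := ((isAltOrbit_altCoord hs (W ε₂)).shift k).signs_of_eq_101_div_100 (sg b3).1
    (sg b3).2.1 (sg b3).2.2.1 (sg b3).2.2.2 (by rw [show 3 + k = K by omega]; exact b2)
  simp only [add_comm _ k] at s1 s2
  -- The breaks occur at times k + 9 and k + 10, so the two limits have opposite signs.
  have t1 := (isOrbit_coord (W ε₁)).tendsto_of_alt_entry hs (m := k + 7) s1.1 s1.2.1 s1.2.2
  have t2 := (isOrbit_coord (W ε₂)).tendsto_of_alt_entry hs (m := k + 8) s2.1 s2.2.1 s2.2.2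
  refine ⟨s * (-1) ^ (k + 7 + 1), ?_, ⟨W ε₁, by rw [hWd _ a0]; exact a1, t1⟩,
    ⟨W ε₂, by rw [hWd _ b0]; exact b1, ?_⟩⟩
  · rcases hs with rfl | rfl <;> rcases neg_one_pow_eq_or ℝ (k + 7 + 1) with e | e <;> simp [e]
  · convert t2 using 3
    ring

theorem stableSet_cycle_subset_closure :
    stableSet {p, p'} ⊆ closure basinPlus ∩ closure basinMinus := by
  intro q hq
  obtain ⟨s₀, hs₀, hlim⟩ := (mem_stableSet_cycle_iff q).1 hq
  obtain ⟨N, hN⟩ := eventually_atTop.1 ((tendsto_iff_norm_sub_tendsto_zero.1 hlim).eventually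
    (gt_mem_nhds (by norm_num : (0 : ℝ) < 1 / 1000)))
  set w := (f ℝ)^[N] q with hwdef
  obtain ⟨s, hs, hw⟩ : ∃ s : ℝ, (s = 1 ∨ s = -1) ∧
      ∀ n, |altCoord s w n - √5 / 2| ≤ 1 / 1000 := by
    refine ⟨s₀ * (-1) ^ N, ?_, fun n => ?_⟩
    · rcases hs₀ with rfl | rfl <;> rcases neg_one_pow_eq_or ℝ N with e | e <;> simp [e]
    · have e : altCoord (s₀ * (-1) ^ N) w n = s₀ * ((-1) ^ (n + N) * coord ℝ q (n + N)) := by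
        rw [altCoord, hwdef, coord_iterate]
        ring
      rw [e]
      exact (hN (n + N) (by omega)).le
  have key : ∀ ε > 0, (∃ z ∈ basinPlus, dist w z < ε) ∧ ∃ z ∈ basinMinus, dist w z < ε := by
    intro ε hε
    have hlt : min (ε / 2) (1 / 100) < ε := (min_le_left _ _).trans_lt (by linarith)
    obtain ⟨t, ht, ⟨z₁, d1, l1⟩, z₂, d2, l2⟩ := exists_near_of_altCoord hs hw
      (η := min (ε / 2) (1 / 100)) (by positivity) (min_le_right _ _)
    rcases ht with rfl | rfl
    · exact ⟨⟨z₁, (mem_basinPlus_iff _).2 l1, d1.trans_lt hlt⟩,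
        z₂, (mem_basinMinus_iff _).2 l2, d2.trans_lt hlt⟩
    · refine ⟨⟨z₂, (mem_basinPlus_iff _).2 (by simpa using l2), d2.trans_lt hlt⟩,
        z₁, (mem_basinMinus_iff _).2 l1, d1.trans_lt hlt⟩
  constructor
  · rw [← iterate_mem_closure_iff f_mem_basinPlus_iff N, Metric.mem_closure_iff]
    exact fun ε hε => (key ε hε).1
  · rw [← iterate_mem_closure_iff f_mem_basinMinus_iff N, Metric.mem_closure_iff]
    exact fun ε hε => (key ε hε).2

theorem stableSets_subset_frontier_basinPlus :
    stableSet {(0, 0)} ∪ stableSet {p, p'} ⊆ frontier basinPlus := by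
  intro q hq
  rw [isOpen_basinPlus.frontier_eq]
  refine ⟨?_, fun h => not_tendsto_half_of_mem hq (by norm_num) ((mem_basinPlus_iff q).1 h)⟩
  rcases hq with hq | hq
  · exact stableSet_zero_subset_closure_basinPlus hq
  · exact (stableSet_cycle_subset_closure hq).1

theorem stableSets_subset_frontier_basinMinus :
    stableSet {(0, 0)} ∪ stableSet {p, p'} ⊆ frontier basinMinus := by
  intro q hq
  rw [isOpen_basinMinus.frontier_eq]
  refine ⟨?_, fun h => not_tendsto_half_of_mem hq (by norm_num) ((mem_basinMinus_iff q).1 h)⟩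
  rcases hq with hq | hq
  · exact stableSet_zero_subset_closure_basinMinus hq
  · exact (stableSet_cycle_subset_closure hq).2

/-! ### The stable sets lie in the Julia set -/

/-- The first coordinate of norm above R would dominate its predecessor and put the orbit in the
escape region. The bound is uniform in n and z, as Cauchy's estimate requires. -/
theorem norm_coord_le_of_mem_KPlus {z : ℂ × ℂ} (hz : z ∈ KPlus) {R : ℝ} (hR : 2 ≤ R)
    (h : ‖z‖ ≤ R) (n : ℕ) : ‖coord ℂ z n‖ ≤ R := by
  have key : ∀ n, ‖coord ℂ z n‖ ≤ R ∧ ‖coord ℂ z (n + 1)‖ ≤ R := by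
    intro n
    induction n with
    | zero => exact ⟨(norm_fst_le z).trans h, (norm_snd_le z).trans h⟩
    | succ n ih =>
      refine ⟨ih.2, ?_⟩
      by_contra hcon
      push Not at hcon
      exact escapingSet_subset (mem_escapingSet_of_le (n := n + 1) (by linarith)
        (ih.2.trans hcon.le)) hz
  exact (key n).1

theorem differentiable_coord_line (w v : ℂ × ℂ) (n : ℕ) :
    Differentiable ℂ fun t : ℂ => coord ℂ (w + t • v) n := by
  have key : ∀ n, (Differentiable ℂ fun t : ℂ => coord ℂ (w + t • v) n) ∧
      Differentiable ℂ fun t : ℂ => coord ℂ (w + t • v) (n + 1) := by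
    intro n
    induction n with
    | zero =>
      constructor
      · simp only [coord_zero, Prod.fst_add, Prod.smul_fst, smul_eq_mul]
        fun_prop
      · simp only [Nat.zero_add, coord_one, Prod.snd_add, Prod.smul_snd, smul_eq_mul]
        fun_prop
    | succ n ih =>
      refine ⟨ih.2, ?_⟩
      obtain ⟨h0, h1⟩ := ih
      have e : (fun t : ℂ => coord ℂ (w + t • v) (n + 1 + 1)) = fun t => coord ℂ (w + t • v) n / 2 -
          coord ℂ (w + t • v) (n + 1) ^ 3 + 3 / 4 * coord ℂ (w + t • v) (n + 1) :=
        funext fun t => isOrbit_coord _ n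
      rw [e]
      exact ((h0.div_const _).sub (h1.pow 3)).add (h1.const_mul _)
  exact (key n).1

theorem deriv_coord_line (w v : ℂ × ℂ) (n : ℕ) :
    deriv (fun t : ℂ => coord ℂ (w + t • v) (n + 2)) 0 =
      deriv (fun t : ℂ => coord ℂ (w + t • v) n) 0 / 2 +
        (3 / 4 - 3 * coord ℂ w (n + 1) ^ 2) *
          deriv (fun t : ℂ => coord ℂ (w + t • v) (n + 1)) 0 := by
  have h0 := (differentiable_coord_line w v n 0).hasDerivAt
  have h1 := (differentiable_coord_line w v (n + 1) 0).hasDerivAt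
  have e : (fun t : ℂ => coord ℂ (w + t • v) (n + 2)) = fun t => coord ℂ (w + t • v) n / 2 -
      coord ℂ (w + t • v) (n + 1) ^ 3 + 3 / 4 * coord ℂ (w + t • v) (n + 1) :=
    funext fun t => isOrbit_coord _ n
  rw [e]
  refine ((((h0.div_const 2).sub (h1.pow 3)).add (h1.const_mul (3 / 4))).deriv).trans ?_
  simp only [zero_smul, add_zero]
  push_cast
  ring

/-- Cauchy's estimate on the circle of radius r / 2 in the complex line w + t v, which stays inside
a ball contained in K⁺. -/
theorem exists_norm_deriv_le {w : ℂ × ℂ} (hw : w ∈ interior KPlus) {v : ℂ × ℂ} (hv : ‖v‖ ≤ 1) :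
    ∃ C, ∀ n, ‖deriv (fun t : ℂ => coord ℂ (w + t • v) n) 0‖ ≤ C := by
  obtain ⟨r, hr, hball⟩ := Metric.isOpen_iff.1 isOpen_interior w hw
  refine ⟨(2 + ‖w‖ + r) / (r / 2), fun n => ?_⟩
  refine Complex.norm_deriv_le_of_forall_mem_sphere_norm_le (by positivity)
    (differentiable_coord_line w v n).diffContOnCl fun t ht => ?_
  have ht : ‖t‖ = r / 2 := by simpa using ht
  have hle : ‖t • v‖ ≤ r / 2 := by
    rw [norm_smul, ht]
    nlinarith
  refine norm_coord_le_of_mem_KPlus (interior_subset (hball ?_)) (by linarith [norm_nonneg w]) ?_ n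
  · rw [Metric.mem_ball, dist_eq_norm, add_sub_cancel_left]
    linarith
  · refine (norm_add_le _ _).trans ?_
    linarith

/-- A point at which the derivatives of the iterates expand a real direction is not interior to
`K⁺`. -/
theorem notMem_interior_KPlus {q : ℝ × ℝ} {σ : ℝ} (hσ : σ = 1 ∨ σ = -1)
    (hq : ∀ n, 9 / 16 ≤ σ * (3 / 4 - 3 * coord ℝ q n ^ 2)) : toComplex q ∉ interior KPlus := by
  intro hint
  have hv : ‖((1, σ) : ℂ × ℂ)‖ ≤ 1 := by
    refine max_le (by simp) ?_
    rcases hσ with rfl | rfl <;> simp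
  obtain ⟨C, hC⟩ := exists_norm_deriv_le hint hv
  have hrec := deriv_coord_line (toComplex q) (1, σ)
  have hD0 : deriv (fun t : ℂ => coord ℂ (toComplex q + t • ((1, σ) : ℂ × ℂ)) 0) 0 = 1 := by
    simp [coord_zero]
  have hD1 : deriv (fun t : ℂ => coord ℂ (toComplex q + t • ((1, σ) : ℂ × ℂ)) 1) 0 = σ := by
    simp [coord_one]
  set D : ℕ → ℂ := fun n => deriv (fun t : ℂ => coord ℂ (toComplex q + t • ((1, σ) : ℂ × ℂ)) n) 0
    with hD
  have hrec' : ∀ n, (D (n + 2)).re =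
      (D n).re / 2 + (3 / 4 - 3 * coord ℝ q (n + 1) ^ 2) * (D (n + 1)).re := by
    intro n
    have e : D (n + 2) = ((1 / 2 : ℝ) : ℂ) * D n +
        ((3 / 4 - 3 * coord ℝ q (n + 1) ^ 2 : ℝ) : ℂ) * D (n + 1) := by
      rw [show D (n + 2) = _ from hrec n, coord_toComplex]
      push_cast
      ring
    rw [e, Complex.add_re, Complex.re_ofReal_mul, Complex.re_ofReal_mul]
    ring
  have hσσ : σ * σ = 1 := by rcases hσ with rfl | rfl <;> norm_num
  -- The factor σ^n makes the coefficients of the linearised recurrence positive, 1/2 and at least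
  -- 9/16. Starting from F 0 = F 1 = 1, F grows by 17/16 per block and exceeds C.
  set F : ℕ → ℝ := fun n => σ ^ n * (D n).re with hF
  have hF0 : F 0 = 1 := by
    simp only [hF, pow_zero, one_mul]
    rw [show D 0 = 1 from hD0, Complex.one_re]
  have hF1 : F 1 = 1 := by
    simp only [hF, pow_one]
    rw [show D 1 = σ from hD1, Complex.ofReal_re, hσσ]
  have hFrec : ∀ n, F (n + 2) =
      F n / 2 + σ * (3 / 4 - 3 * coord ℝ q (n + 1) ^ 2) * F (n + 1) := by
    intro n
    simp only [hF, hrec' n]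
    rw [pow_succ, pow_succ]
    linear_combination (σ ^ n * (D n).re / 2) * hσσ
  have hstep : ∀ n, 0 < F (n + 1) → F n / 2 + 9 / 16 * F (n + 1) ≤ F (n + 2) := by
    intro n hn
    rw [hFrec n]
    nlinarith [hq (n + 1)]
  have hpos : ∀ n, 0 < F n ∧ 0 < F (n + 1) := by
    intro n
    induction n with
    | zero => exact ⟨by rw [hF0]; norm_num, by rw [hF1]; norm_num⟩
    | succ n ih =>
      refine ⟨ih.2, ?_⟩
      have := hstep n ih.2
      show 0 < F (n + 2)
      linarith [ih.1, ih.2]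
  have hC0 : 0 ≤ C := (norm_nonneg _).trans (hC 0)
  obtain ⟨N, hN⟩ := eventually_ge_of_min_le (s := F) (B := C + 1) (r := 17 / 16)
    (by linarith) (by norm_num) (hpos 0).1 (hpos 1).1 fun n => by
      refine (min_le_right _ _).trans (le_trans ?_ (hstep n (hpos n).2))
      linarith [min_le_left (F n) (F (n + 1)), min_le_right (F n) (F (n + 1))]
  have habs : |F N| = |(D N).re| := by
    simp only [hF]
    rw [abs_mul, abs_pow]
    rcases hσ with rfl | rfl <;> simp
  have h1 := hN N le_rfl
  have h2 := hC N
  have h3 := Complex.abs_re_le_norm (D N)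
  have h4 := le_abs_self (F N)
  rw [habs] at h4
  have h5 : ‖D N‖ ≤ C := h2
  linarith

theorem toComplex_iterate (q : ℝ × ℝ) (N : ℕ) :
    toComplex ((f ℝ)^[N] q) = (f ℂ)^[N] (toComplex q) := by
  rw [iterate_eq, iterate_eq, coord_toComplex, coord_toComplex]
  rfl

/-- Expansion holds along a late orbit: near 0, |y| < 1/4 gives 3/4 - 3y^2 ≥ 9/16 with σ = 1; near
the cycle, |y| > 9/10 gives 3y^2 - 3/4 ≥ 9/16 with σ = -1. -/
theorem stableSets_subset_realJPlus :
    stableSet {(0, 0)} ∪ stableSet {p, p'} ⊆ realJPlus := by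
  intro q hq
  refine ⟨subset_closure (mem_KPlus_of_mem_stableSets hq), ?_⟩
  have key : ∃ N, toComplex ((f ℝ)^[N] q) ∉ interior KPlus := by
    rcases hq with hq | hq
    · rw [mem_stableSet_zero_iff] at hq
      obtain ⟨N, hN⟩ := eventually_atTop.1 (((tendsto_zero_iff_abs_tendsto_zero _).1 hq).eventually
        (gt_mem_nhds (by norm_num : (0 : ℝ) < 1 / 4)))
      refine ⟨N, notMem_interior_KPlus (Or.inl rfl) fun n => ?_⟩
      have h := hN (n + N) (by omega)
      rw [coord_iterate, ← sq_abs]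
      simp only [Function.comp_apply] at h
      nlinarith [abs_nonneg (coord ℝ q (n + N))]
    · obtain ⟨s, hs, hlim⟩ := (mem_stableSet_cycle_iff q).1 hq
      obtain ⟨N, hN⟩ := eventually_atTop.1 (hlim.eventually
        (lt_mem_nhds (by linarith [sqrt_five_div_two_bounds.1] : (9 / 10 : ℝ) < √5 / 2)))
      refine ⟨N, notMem_interior_KPlus (Or.inr rfl) fun n => ?_⟩
      have h := hN (n + N) (by omega)
      have e : (s * ((-1) ^ (n + N) * coord ℝ q (n + N))) ^ 2 = coord ℝ q (n + N) ^ 2 := by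
        rcases hs with rfl | rfl <;> rcases neg_one_pow_eq_or ℝ (n + N) with e | e <;> simp [e]
      rw [coord_iterate, ← e]
      nlinarith
  obtain ⟨N, hN⟩ := key
  rwa [toComplex_iterate, iterate_mem_interior_iff f_mem_KPlus_iff] at hN

end BieberbachMap

theorem mainTheorem1 :
    frontier BieberbachMap.basinPlus = frontier BieberbachMap.basinMinus ∧
    frontier BieberbachMap.basinMinus =
      BieberbachMap.stableSet {(0, 0)} ∪
        BieberbachMap.stableSet {BieberbachMap.p, BieberbachMap.p'} ∧
    BieberbachMap.stableSet {(0, 0)} ∪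
        BieberbachMap.stableSet {BieberbachMap.p, BieberbachMap.p'} =
      BieberbachMap.realJPlus := by
  have hplus := BieberbachMap.frontier_basinPlus_subset.antisymm
    BieberbachMap.stableSets_subset_frontier_basinPlus
  have hminus := BieberbachMap.frontier_basinMinus_subset.antisymm
    BieberbachMap.stableSets_subset_frontier_basinMinus
  exact ⟨hplus.trans hminus.symm, hminus,
    BieberbachMap.stableSets_subset_realJPlus.antisymm BieberbachMap.realJPlus_subset⟩
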